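/- **Theorem (Optimal policy).** Let $T\ge 1$, $N\ge 1$, $A\in\mathbb R^{n\times n}$, $B\in\mathbb R^{n\times m}$, $\Xi\in\mathbb R^{n\times k}$, let $Q,Q_f\in\mathbb R^{n\times n}$ be symmetric positive semidefinite, $R\in\mathbb R^{m\times m}$ symmetric positive definite, $\lambda>0$, and let $\hat w^{(1)}_t,\dots,\hat w^{(N)}_t\in\mathbb R^k$ ($0\le t<T$) be given sample points with empirical distribution $\nu_t=\frac1N\sum_{i=1}^N\delta_{\hat w_t^{(i)}}$, mean $\bar w_t=\mathbb E_{\nu_t}[w]$ and second-moment matrix $\Sigma_t=\mathbb E_{\nu_t}[ww^\top]$. Consider the system $x_{t+1}=Ax_t+Bu_t+\Xi w_t$. A controller policy $\pi=(\pi_t)$ consists of Borel maps $\pi_t:\mathbb R^n\to\mathbb R^m$, with $u_t=\pi_t(x_t)$; an opponent policy $\gamma=(\gamma_t)$ consists of Borel stochastic kernels from $\mathbb R^n$ to $\mathbb R^k$, where $\mu_t=\gamma_t(x_t)$ is the conditional law of $w_t$ given the history. Let $W_2\in[0,\infty]$ be the Wasserstein distance of order $2$ on $\mathbb R^k$ for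 the Euclidean norm, and put, for $0\le t\le T$, $$J_t(x;\pi,\gamma)=\mathbb E^{\pi,\gamma}\Big[x_T^\top Q_fx_T+\sum_{s=t}^{T-1}\big(x_s^\top Qx_s+u_s^\top Ru_s-\lambda W_2(\mu_s,\nu_s)^2\big)\,\Big|\,x_t=x\Big],$$ understood as the expectation of the (nonnegative) quadratic cost minus the expectation of the (nonnegative) penalty, in $[-\infty,\infty]$, with $\infty-\infty:=-\infty$. Let $V_t(x)=\inf_\pi\sup_\gamma J_t(x;\pi,\gamma)$. The minimax problem from the initial state $x$ is $\min_\pi\max_\gamma J(x;\pi,\gamma)$ with $J=\frac1TJ_0$. Let $\Phi=BR^{-1}B^\top-\frac1\lambda\Xi\Xi^\top$, and define $P_T=Q_f$, $r_T=0$, $z_T=0$ and, for $t=T-1,\dots,0$, $$\begin{aligned} P_t&=Q+A^\top(I+P_{t+1}\Phi)^{-1}P_{t+1}A,\\ r_t&=A^\top(I+P_{t+1}\Phi)^{-1}(P_{t+1}\Xi\bar w_t+r_{t+1}),\\ z_t&=z_{t+1}+\operatorname{tr}\big[(I-\Xi^\top P_{t+1}\Xi/\lambda)^{-1}\Xi^\top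 P_{t+1}\Xi\Sigma_t\big]\\ &\quad+\bar w_t^\top\Xi^\top\big[(I+P_{t+1}\Phi)^{-1}-(I-P_{t+1}\Xi\Xi^\top/\lambda)^{-1}\big]P_{t+1}\Xi\bar w_t\\ &\quad+(2\bar w_t^\top\Xi^\top-r_{t+1}^\top\Phi)(I+P_{t+1}\Phi)^{-1}r_{t+1},\\ K_t&=-R^{-1}B^\top(I+P_{t+1}\Phi)^{-1}P_{t+1}A,\\ L_t&=-R^{-1}B^\top(I+P_{t+1}\Phi)^{-1}(P_{t+1}\Xi\bar w_t+r_{t+1}). \end{aligned}$$ Assume that for every $t=1,\dots,T$ all eigenvalues of $\Xi^\top P_t\Xi$ are smaller than $\lambda$. Then: 1. The recursion is well defined: for $0\le t<T$ the matrices $I+P_{t+1}\Phi$, $I-\Xi^\top P_{t+1}\Xi/\lambda$, $I-P_{t+1}\Xi\Xi^\top/\lambda$ and $\lambda I-\Xi^\top P_{t+1}\Xi$ are invertible; and every $P_t$, $0\le t\le T$, is symmetric positive semidefinite. 2. $V_t(x)=x^\top P_tx+2r_t^\top x+z_t$ for all $x\in\mathbb R^n$ and $t=0,\dots,T$. 3.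 The affine policy $\pi^\star_t(x)=K_tx+L_t$ is optimal: $\sup_\gamma J_t(x;\pi^\star,\gamma)=V_t(x)$ for all $t$ and $x$; in particular it solves the minimax problem from every initial state. 4. It is unique: if $t<T$ and a policy $\pi$ satisfies $\sup_\gamma J_t(x;\pi,\gamma)=V_t(x)$, then $\pi_t(x)=K_tx+L_t$. Hence $\pi^\star$ is the only policy $(\pi_0,\dots,\pi_{T-1})$ that is optimal from every stage and state. Moreover, if $\pi$ solves the minimax problem from a fixed initial state $x_0=x$, then almost surely $\pi_t(x_t)=K_tx_t+L_t$ for all $t<T$ along the state trajectory generated by $(\pi^\star,\gamma^\star)$, with $\gamma^\star$ as in 5. 5. Let $$w^{\star,(i)}_t(x)=(\lambda I-\Xi^\top P_{t+1}\Xi)^{-1}\big(\Xi^\top P_{t+1}(Ax+BK_tx+BL_t)+\Xi^\top r_{t+1}+\lambda\hat w^{(i)}_t\big),\qquad \gamma^\star_t(x)=\frac1N\sum_{i=1}^N\delta_{w^{\star,(i)}_t(x)}.$$ Then $\gamma^\star$ is a worst-case, finitely supported opponent policy: $J_t(x;\pi^\star,\gamma^\star)=\sup_\gamma J_t(x;\pi^\star,\gamma)$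 for all $x$ and $t\le T$, and $(\pi^\star,\gamma^\star)$ is an optimal minimax solution, i.e. $J(x;\pi^\star,\gamma^\star)=\sup_\gamma J(x;\pi^\star,\gamma)=\inf_\pi\sup_\gamma J(x;\pi,\gamma)$. -/

import Mathlib

open MeasureTheory ProbabilityTheory Matrix
open scoped ENNReal

/-- Data of a finite-horizon linear-quadratic problem with Wasserstein penalty:
`x_{t+1} = A x_t + B u_t + Ξ w_t`, cost matrices `Q`, `Qf`, `R`, penalty parameter `lam`,
horizon `T` and sample points `sample t i` (the `i`-th sample of the disturbance at stage `t`).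
Sign and definiteness conditions are hypotheses of the theorem. -/
structure LQData (n m k N : ℕ) where
  A : Matrix (Fin n) (Fin n) ℝ
  B : Matrix (Fin n) (Fin m) ℝ
  Ξ : Matrix (Fin n) (Fin k) ℝ
  Q : Matrix (Fin n) (Fin n) ℝ
  Qf : Matrix (Fin n) (Fin n) ℝ
  R : Matrix (Fin m) (Fin m) ℝ
  lam : ℝ
  T : ℕ
  sample : ℕ → Fin N → Fin k → ℝ

/-- The Wasserstein distance of order two on `ℝ^k` for the Euclidean norm, with values in
`[0, ∞]`: infimum of `(∫ ‖x - y‖² dη)^{1/2}` over all couplings `η` of `μ` and `ν`. -/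
noncomputable def wasserstein2 {k : ℕ} (μ ν : Measure (Fin k → ℝ)) : ℝ≥0∞ :=
  ⨅ η : {η : Measure ((Fin k → ℝ) × (Fin k → ℝ)) //
      η.map Prod.fst = μ ∧ η.map Prod.snd = ν},
    (∫⁻ p, ‖WithLp.toLp 2 (p.1 - p.2)‖ₑ ^ 2 ∂η.1) ^ (1 / 2 : ℝ)

/-- The controller's policies: one Borel map from states to inputs for each stage. -/
structure ControlPolicy (n m : ℕ) where
  act : ℕ → (Fin n → ℝ) → (Fin m → ℝ)
  measurable_act : ∀ t, Measurable (act t)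

/-- The opponent's policies: one Borel stochastic kernel from states to disturbances for each
stage; `law t x` is the distribution of the disturbance chosen at stage `t` in state `x`. -/
structure OpponentPolicy (n k : ℕ) where
  law : ℕ → Kernel (Fin n → ℝ) (Fin k → ℝ)
  markov : ∀ t, IsMarkovKernel (law t)

namespace LQData

variable {n m k N : ℕ} (d : LQData n m k N)

/-! ### Empirical distributions and the Riccati recursion -/

/-- The empirical distribution of the samples at stage `t`. -/
noncomputable def empirical (t : ℕ) : Measure (Fin k → ℝ) :=
  (N : ℝ≥0∞)⁻¹ • ∑ i, Measure.dirac (d.sample t i)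

/-- The mean of the empirical distribution at stage `t`. -/
noncomputable def mean (t : ℕ) : Fin k → ℝ := ∫ w, w ∂d.empirical t

/-- The matrix `E[w wᵀ]` of the empirical distribution at stage `t`. -/
noncomputable def secondMoment (t : ℕ) : Matrix (Fin k) (Fin k) ℝ :=
  Matrix.of fun i j => ∫ w, w i * w j ∂d.empirical t

/-- `Φ = B R⁻¹ Bᵀ - λ⁻¹ Ξ Ξᵀ`. -/
noncomputable def Φ : Matrix (Fin n) (Fin n) ℝ :=
  d.B * d.R⁻¹ * d.Bᵀ - (1 / d.lam) • (d.Ξ * d.Ξᵀ)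

/-- `P` as a function of the number of remaining stages. -/
noncomputable def PToGo : ℕ → Matrix (Fin n) (Fin n) ℝ
  | 0 => d.Qf
  | j + 1 => d.Q + d.Aᵀ * (1 + PToGo j * d.Φ)⁻¹ * PToGo j * d.A

/-- `r` as a function of the number of remaining stages. -/
noncomputable def rToGo : ℕ → (Fin n → ℝ)
  | 0 => 0
  | j + 1 => (d.Aᵀ * (1 + d.PToGo j * d.Φ)⁻¹) *ᵥ
      ((d.PToGo j * d.Ξ) *ᵥ d.mean (d.T - (j + 1)) + rToGo j)

/-- `z` as a function of the number of remaining stages. -/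
noncomputable def zToGo : ℕ → ℝ
  | 0 => 0
  | j + 1 =>
    let t := d.T - (j + 1)
    let P := d.PToGo j
    let r := d.rToGo j
    let wbar := d.mean t
    zToGo j
      + ((1 - (1 / d.lam) • (d.Ξᵀ * P * d.Ξ))⁻¹ * d.Ξᵀ * P * d.Ξ * d.secondMoment t).trace
      + wbar ⬝ᵥ ((d.Ξᵀ * ((1 + P * d.Φ)⁻¹ - (1 - (1 / d.lam) • (P * d.Ξ * d.Ξᵀ))⁻¹)
          * P * d.Ξ) *ᵥ wbar)
      + ((2 : ℝ) • (d.Ξ *ᵥ wbar) - d.Φᵀ *ᵥ r) ⬝ᵥ ((1 + P * d.Φ)⁻¹ *ᵥ r)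

noncomputable def P (t : ℕ) : Matrix (Fin n) (Fin n) ℝ := d.PToGo (d.T - t)

noncomputable def r (t : ℕ) : Fin n → ℝ := d.rToGo (d.T - t)

noncomputable def z (t : ℕ) : ℝ := d.zToGo (d.T - t)

theorem P_last : d.P d.T = d.Qf := by simp [P, PToGo]

theorem r_last : d.r d.T = 0 := by simp [r, rToGo]

theorem z_last : d.z d.T = 0 := by simp [z, zToGo]

/-- The backward recursion for `P`. -/
theorem P_step {t : ℕ} (ht : t < d.T) :
    d.P t = d.Q + d.Aᵀ * (1 + d.P (t + 1) * d.Φ)⁻¹ * d.P (t + 1) * d.A := by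
  have h : d.T - t = (d.T - (t + 1)) + 1 := by omega
  rw [P, h, PToGo, P]

/-- The backward recursion for `r`. -/
theorem r_step {t : ℕ} (ht : t < d.T) :
    d.r t = (d.Aᵀ * (1 + d.P (t + 1) * d.Φ)⁻¹) *ᵥ
      ((d.P (t + 1) * d.Ξ) *ᵥ d.mean t + d.r (t + 1)) := by
  have h : d.T - t = (d.T - (t + 1)) + 1 := by omega
  have h' : d.T - (d.T - (t + 1) + 1) = t := by omega
  rw [r, h, rToGo, h', P, r]

/-- The backward recursion for `z`. -/
theorem z_step {t : ℕ} (ht : t < d.T) :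
    d.z t = d.z (t + 1)
      + ((1 - (1 / d.lam) • (d.Ξᵀ * d.P (t + 1) * d.Ξ))⁻¹
          * d.Ξᵀ * d.P (t + 1) * d.Ξ * d.secondMoment t).trace
      + d.mean t ⬝ᵥ ((d.Ξᵀ * ((1 + d.P (t + 1) * d.Φ)⁻¹
          - (1 - (1 / d.lam) • (d.P (t + 1) * d.Ξ * d.Ξᵀ))⁻¹)
          * d.P (t + 1) * d.Ξ) *ᵥ d.mean t)
      + ((2 : ℝ) • (d.Ξ *ᵥ d.mean t) - d.Φᵀ *ᵥ d.r (t + 1)) ⬝ᵥ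
          ((1 + d.P (t + 1) * d.Φ)⁻¹ *ᵥ d.r (t + 1)) := by
  have h : d.T - t = (d.T - (t + 1)) + 1 := by omega
  have h' : d.T - (d.T - (t + 1) + 1) = t := by omega
  rw [z, h, zToGo, h', P, r, z]

/-- `K_t = -R⁻¹ Bᵀ (I + P_{t+1} Φ)⁻¹ P_{t+1} A`. -/
noncomputable def K (t : ℕ) : Matrix (Fin m) (Fin n) ℝ :=
  -(d.R⁻¹ * d.Bᵀ * (1 + d.P (t + 1) * d.Φ)⁻¹ * d.P (t + 1) * d.A)

/-- `L_t = -R⁻¹ Bᵀ (I + P_{t+1} Φ)⁻¹ (P_{t+1} Ξ w̄_t + r_{t+1})`. -/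
noncomputable def L (t : ℕ) : Fin m → ℝ :=
  -((d.R⁻¹ * d.Bᵀ * (1 + d.P (t + 1) * d.Φ)⁻¹) *ᵥ
    ((d.P (t + 1) * d.Ξ) *ᵥ d.mean t + d.r (t + 1)))

/-- The affine policy `x ↦ K_t x + L_t`. -/
noncomputable def optPolicy : ControlPolicy n m where
  act t x := d.K t *ᵥ x + d.L t
  measurable_act t := Continuous.measurable (by fun_prop)

/-- The support points of the worst-case distribution at stage `t` in state `x`. -/
noncomputable def worstPoint (t : ℕ) (i : Fin N) (x : Fin n → ℝ) : Fin k → ℝ :=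
  (d.lam • (1 : Matrix (Fin k) (Fin k) ℝ) - d.Ξᵀ * d.P (t + 1) * d.Ξ)⁻¹ *ᵥ
    ((d.Ξᵀ * d.P (t + 1)) *ᵥ
        (d.A *ᵥ x + d.B *ᵥ (d.K t *ᵥ x) + d.B *ᵥ d.L t)
      + d.Ξᵀ *ᵥ d.r (t + 1) + d.lam • d.sample t i)

theorem measurable_worstPoint (t : ℕ) (i : Fin N) : Measurable (d.worstPoint t i) := by
  unfold worstPoint
  exact Continuous.measurable (by fun_prop)

/-- The opponent's policy `x ↦ N⁻¹ ∑ i, δ_{w i}`, where the `w i` are the points `worstPoint`. -/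
noncomputable def worstPolicy [NeZero N] : OpponentPolicy n k where
  law t :=
    { toFun := fun x => (N : ℝ≥0∞)⁻¹ • ∑ i, Measure.dirac (d.worstPoint t i x)
      measurable' := by
        refine Measure.measurable_of_measurable_coe _ fun s hs => ?_
        simp only [Measure.smul_apply, Measure.finsetSum_apply, smul_eq_mul]
        refine Measurable.const_mul (Finset.measurable_sum _ fun i _ => ?_) _
        exact (Measure.measurable_coe hs).comp
          (Measure.measurable_dirac.comp (d.measurable_worstPoint t i)) }
  markov t := ⟨fun x => ⟨by
    have hN : (N : ℝ≥0∞) ≠ 0 := by exact_mod_cast NeZero.ne N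
    change ((N : ℝ≥0∞)⁻¹ • ∑ i, Measure.dirac (d.worstPoint t i x)) Set.univ = 1
    simp [Measure.finsetSum_apply, ENNReal.inv_mul_cancel hN]⟩⟩

/-! ### The controlled process and the minimax problem -/

/-- Transition kernel of the state at stage `t`: the law of `A x + B π_t(x) + Ξ w` for
`w` distributed according to `γ_t(x)`. -/
noncomputable def step (π : ControlPolicy n m) (γ : OpponentPolicy n k) (t : ℕ) :
    Kernel (Fin n → ℝ) (Fin n → ℝ) :=
  (Kernel.id ×ₖ γ.law t).map
    fun p => d.A *ᵥ p.1 + d.B *ᵥ π.act t p.1 + d.Ξ *ᵥ p.2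

theorem measurable_next (π : ControlPolicy n m) (t : ℕ) :
    Measurable fun p : (Fin n → ℝ) × (Fin k → ℝ) =>
      d.A *ᵥ p.1 + d.B *ᵥ π.act t p.1 + d.Ξ *ᵥ p.2 := by
  have hB : Measurable fun u : Fin m → ℝ => d.B *ᵥ u := Continuous.measurable (by fun_prop)
  have hA : Measurable fun u : Fin n → ℝ => d.A *ᵥ u := Continuous.measurable (by fun_prop)
  have hΞ : Measurable fun u : Fin k → ℝ => d.Ξ *ᵥ u := Continuous.measurable (by fun_prop)
  exact ((hA.comp measurable_fst).add
    (hB.comp ((π.measurable_act t).comp measurable_fst))).add (hΞ.comp measurable_snd)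

instance (π : ControlPolicy n m) (γ : OpponentPolicy n k) (t : ℕ) :
    IsMarkovKernel (d.step π γ t) := by
  have := γ.markov t
  exact Kernel.IsMarkovKernel.map _ (d.measurable_next π t)

/-- The transition kernel, read on the history up to time `s`. -/
noncomputable def historyStep (π : ControlPolicy n m) (γ : OpponentPolicy n k) (s : ℕ) :
    Kernel ((i : Finset.Iic s) → (fun _ : ℕ => Fin n → ℝ) i) (Fin n → ℝ) :=
  (d.step π γ s).comap (fun h => h ⟨s, Finset.mem_Iic.2 le_rfl⟩) (measurable_pi_apply _)

instance (π : ControlPolicy n m) (γ : OpponentPolicy n k) (s : ℕ) :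
    IsMarkovKernel (d.historyStep π γ s) := by
  unfold historyStep; infer_instance

/-- The law of the state trajectory under `(π, γ)` given `x_t = x` (Ionescu-Tulcea). The
coordinates before time `t`, which play no role, are set to `x`. -/
noncomputable def pathLaw (π : ControlPolicy n m) (γ : OpponentPolicy n k) (t : ℕ)
    (x : Fin n → ℝ) : Measure (ℕ → Fin n → ℝ) :=
  Kernel.traj (X := fun _ => Fin n → ℝ) (d.historyStep π γ) t (fun _ => x)

/-- The quadratic cost collected along a trajectory from stage `t` on. -/
noncomputable def quadCost (π : ControlPolicy n m) (t : ℕ) (ω : ℕ → Fin n → ℝ) : ℝ :=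
  ∑ s ∈ Finset.Ico t d.T,
      (ω s ⬝ᵥ (d.Q *ᵥ ω s) + π.act s (ω s) ⬝ᵥ (d.R *ᵥ π.act s (ω s)))
    + ω d.T ⬝ᵥ (d.Qf *ᵥ ω d.T)

/-- The Wasserstein penalty collected along a trajectory from stage `t` on. -/
noncomputable def penalty (γ : OpponentPolicy n k) (t : ℕ) (ω : ℕ → Fin n → ℝ) : ℝ≥0∞ :=
  ∑ s ∈ Finset.Ico t d.T,
    ENNReal.ofReal d.lam * wasserstein2 (γ.law s (ω s)) (d.empirical s) ^ 2

/-- The expected penalized cost-to-go from stage `t` given `x_t = x`: expectation of the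
(nonnegative) quadratic cost minus expectation of the (nonnegative) penalty, in `[-∞, ∞]`. If both
are infinite, the value is `-∞` (this is the convention `⊤ - ⊤ = ⊥` of `EReal`): an opponent
with infinite expected penalty gains nothing. -/
noncomputable def costToGo (t : ℕ) (x : Fin n → ℝ) (π : ControlPolicy n m)
    (γ : OpponentPolicy n k) : EReal :=
  ((∫⁻ ω, ENNReal.ofReal (d.quadCost π t ω) ∂d.pathLaw π γ t x : ℝ≥0∞) : EReal)
    - ((∫⁻ ω, d.penalty γ t ω ∂d.pathLaw π γ t x : ℝ≥0∞) : EReal)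

/-- The optimal value function `V_t`. -/
noncomputable def valueFn (t : ℕ) (x : Fin n → ℝ) : EReal :=
  ⨅ π : ControlPolicy n m, ⨆ γ : OpponentPolicy n k, d.costToGo t x π γ

/-- `π` minimizes the worst-case expected cost-to-go from stage `t` given `x_t = x`. -/
def IsOptimalAt (t : ℕ) (x : Fin n → ℝ) (π : ControlPolicy n m) : Prop :=
  (⨆ γ : OpponentPolicy n k, d.costToGo t x π γ) = d.valueFn t x

/-- The averaged penalized cost `J` over the whole horizon, given `x_0 = x`. -/
noncomputable def J (x : Fin n → ℝ) (π : ControlPolicy n m) (γ : OpponentPolicy n k) : EReal :=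
  ((1 / d.T : ℝ) : EReal) * d.costToGo 0 x π γ

end LQData

/-! ### Matrix algebra behind the Riccati recursion -/

section Algebra

variable {ι κ : Type*} [Fintype ι] [Fintype κ]

/-! This is a verification argument: `quadValue` is the candidate value, and `optPolicy` and
`worstPolicy` form a saddle point attaining it. When the costs involved are integrable, the expected
quadratic cost equals the candidate at the initial state plus the telescoped expected stage gains
(`integral_quadCost`), so it suffices to study one stage.

Upper bound. Under the affine input, the next value minus `λ|w' - w|²` is strictly concave in `w'`,
because `λI - ΞᵀPΞ` is positive definite, and `worst` solves its first-order condition. The next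
value and the maximum, as a function of `w`, are thus a feasible dual pair for optimal transport.
Weak Kantorovich duality (`ofReal_integral_sub_integral_le`) bounds the stage gain by `λW₂²`, since
the sample average of the maximum is fixed by `Regular.stage_value`.

Lower bound. The law chosen by `worstPolicy` ignores the actual input, so the stage cost against it
is a strictly convex quadratic in the input, stationary at the affine one. The stage gain is then a
positive definite excess plus the cost of pairing each sample with its support point
(`Regular.stageGain_worstPolicy`), and that pairing costs at least `λW₂²`. The excess vanishes only
at the affine input, whence uniqueness.

The saddle point is organised by the costate `p = Py + r`, with `y = Ax + Ξw̄ - Φp` the mean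
successor: the input is `-R⁻¹Bᵀp` and the mean disturbance is `w̄ + λ⁻¹Ξᵀp`.

Integrability comes from two sources. An infinite expected penalty makes the payoff `-∞`, and a
finite one forces finite second moments of the states. Against `worstPolicy` the state takes
finitely many values, so arbitrary Borel policies cause no trouble. -/

theorem dotProduct_mulVec_eq_transpose_mulVec_dotProduct (M : Matrix ι κ ℝ) (x : ι → ℝ)
    (y : κ → ℝ) : x ⬝ᵥ (M *ᵥ y) = (Mᵀ *ᵥ x) ⬝ᵥ y := by
  rw [Matrix.dotProduct_mulVec, Matrix.mulVec_transpose]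

omit [Fintype ι] in
theorem Matrix.PosSemidef.transpose_eq {P : Matrix ι ι ℝ} (hP : P.PosSemidef) : Pᵀ = P := by
  simpa using hP.isHermitian.eq

theorem Matrix.PosSemidef.dotProduct_mulVec_comm {P : Matrix ι ι ℝ} (hP : P.PosSemidef)
    (x y : ι → ℝ) : x ⬝ᵥ (P *ᵥ y) = y ⬝ᵥ (P *ᵥ x) := by
  rw [dotProduct_mulVec_eq_transpose_mulVec_dotProduct, hP.transpose_eq, dotProduct_comm]

theorem Matrix.PosSemidef.dotProduct_nonneg {P : Matrix ι ι ℝ} (hP : P.PosSemidef)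
    (x : ι → ℝ) : 0 ≤ x ⬝ᵥ (P *ᵥ x) := by
  simpa using hP.dotProduct_mulVec_nonneg x

theorem Matrix.PosDef.dotProduct_pos {P : Matrix ι ι ℝ} (hP : P.PosDef)
    {x : ι → ℝ} (hx : x ≠ 0) : 0 < x ⬝ᵥ (P *ᵥ x) := by
  simpa using hP.dotProduct_mulVec_pos hx

/-- A Hermitian matrix all of whose eigenvalues are smaller than `l` is smaller than `l`. -/
theorem Matrix.IsHermitian.posDef_smul_one_sub [DecidableEq ι] {H : Matrix ι ι ℝ}
    (hH : H.IsHermitian) {l : ℝ}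
    (h : ∀ μ : ℝ, Module.End.HasEigenvalue (Matrix.toLin' H) μ → μ < l) :
    (l • (1 : Matrix ι ι ℝ) - H).PosDef := by
  have hS : (l • (1 : Matrix ι ι ℝ) - H).IsHermitian := by
    refine IsHermitian.sub ?_ hH
    simp [IsHermitian]
  rw [hS.posDef_iff_eigenvalues_pos]
  intro i
  have hv := hS.mulVec_eigenvectorBasis i
  set v : ι → ℝ := WithLp.ofLp (hS.eigenvectorBasis i) with hvdef
  have hv0 : v ≠ 0 := fun h0 =>
    hS.eigenvectorBasis.orthonormal.ne_zero i ((WithLp.ofLp_eq_zero 2).1 h0)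
  have hHv : H *ᵥ v = (l - hS.eigenvalues i) • v := by
    rw [sub_mulVec, smul_mulVec, one_mulVec] at hv
    rw [sub_smul, ← hv]
    simp
  have := h (l - hS.eigenvalues i) (Module.End.hasEigenvalue_of_hasEigenvector
    (x := v) ⟨Module.End.mem_eigenspace_iff.2 (by simpa using hHv), hv0⟩)
  linarith

theorem dotProduct_transpose_mul_mul_mulVec (P : Matrix ι ι ℝ) (Ξ : Matrix ι κ ℝ) (q : κ → ℝ) :
    q ⬝ᵥ ((Ξᵀ * P * Ξ) *ᵥ q) = (Ξ *ᵥ q) ⬝ᵥ (P *ᵥ (Ξ *ᵥ q)) := by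
  rw [Matrix.mul_assoc, ← mulVec_mulVec, dotProduct_mulVec_eq_transpose_mulVec_dotProduct,
    transpose_transpose, mulVec_mulVec]

variable {P : Matrix ι ι ℝ} {Ξ : Matrix ι κ ℝ} {l : ℝ} [DecidableEq κ]

/-- Nonnegativity of `P` at `l • y - Ξ q`; the choice of `q` turns the cross term into `q ⬝ᵥ q`. It
converts the eigenvalue assumption into control of the negative term in `dotProduct_costate`. -/
theorem quadForm_sub_gap (hP : P.PosSemidef) (y : ι → ℝ) (q : κ → ℝ)
    (hq : q = Ξᵀ *ᵥ (P *ᵥ y)) :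
    q ⬝ᵥ ((l • (1 : Matrix κ κ ℝ) - Ξᵀ * P * Ξ) *ᵥ q) ≤
      l * (l * (y ⬝ᵥ (P *ᵥ y)) - q ⬝ᵥ q) := by
  have h1 := hP.dotProduct_nonneg (l • y - Ξ *ᵥ q)
  have h2 : (Ξ *ᵥ q) ⬝ᵥ (P *ᵥ y) = q ⬝ᵥ q := by
    rw [← transpose_transpose Ξ, ← dotProduct_mulVec_eq_transpose_mulVec_dotProduct, ← hq]
  have h3 := hP.dotProduct_mulVec_comm (Ξ *ᵥ q) y
  simp only [mulVec_sub, mulVec_smul, sub_dotProduct, dotProduct_sub, smul_dotProduct,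
    dotProduct_smul, smul_eq_mul] at h1
  rw [sub_mulVec, dotProduct_sub, dotProduct_transpose_mul_mul_mulVec, smul_mulVec, one_mulVec,
    dotProduct_smul, smul_eq_mul]
  rw [← h3, h2] at h1
  linarith

variable [DecidableEq ι] {G : Matrix ι ι ℝ}

omit [DecidableEq κ] in
/-- The value of the quadratic form of `(1 + P Φ)⁻¹ P`. -/
theorem dotProduct_costate (x p : ι → ℝ)
    (hp : (1 + P * (G - (1 / l) • (Ξ * Ξᵀ))) *ᵥ p = P *ᵥ x) :
    ∃ y, p = P *ᵥ y ∧ x ⬝ᵥ p = y ⬝ᵥ (P *ᵥ y) - (1 / l) * ((Ξᵀ *ᵥ p) ⬝ᵥ (Ξᵀ *ᵥ p))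
      + p ⬝ᵥ (G *ᵥ p) := by
  have h : P *ᵥ (x - (G - (1 / l) • (Ξ * Ξᵀ)) *ᵥ p) = p := by
    rw [mulVec_sub, ← hp, add_mulVec, one_mulVec, mulVec_mulVec, add_sub_cancel_right]
  refine ⟨x - (G - (1 / l) • (Ξ * Ξᵀ)) *ᵥ p, h.symm, ?_⟩
  rw [h, sub_dotProduct, sub_mulVec, sub_dotProduct, smul_mulVec, smul_dotProduct,
    dotProduct_comm (G *ᵥ p), ← mulVec_mulVec, dotProduct_comm (Ξ *ᵥ _),
    dotProduct_mulVec_eq_transpose_mulVec_dotProduct Ξ]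
  simp only [smul_eq_mul]
  ring

/-- For a kernel vector `p = P y`, the costate identity at `x = 0` is a vanishing sum whose only
negative term is the one in `q = Ξᵀ p`. The gap inequality forces `q = 0`, then `yᵀPy = 0`, then `P
y = 0`. -/
theorem isUnit_one_add_mul (hP : P.PosSemidef) (hG : G.PosSemidef) (hl : 0 < l)
    (hS : (l • (1 : Matrix κ κ ℝ) - Ξᵀ * P * Ξ).PosDef) :
    IsUnit (1 + P * (G - (1 / l) • (Ξ * Ξᵀ))) := by
  rw [← mulVec_injective_iff_isUnit, ← coe_mulVecLin, injective_iff_map_eq_zero]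
  intro p hp
  rw [mulVecLin_apply] at hp
  obtain ⟨y, hpy, h⟩ := dotProduct_costate 0 p (by rw [hp, mulVec_zero])
  have hG' := hG.dotProduct_nonneg p
  have hP' := hP.dotProduct_nonneg y
  have hgap := quadForm_sub_gap (l := l) hP y (Ξᵀ *ᵥ p) (by rw [hpy])
  set q := Ξᵀ *ᵥ p
  rw [zero_dotProduct] at h
  have hq : q = 0 := by
    by_contra hq
    have h1 := hS.dotProduct_pos hq
    have h3 : l * (y ⬝ᵥ (P *ᵥ y)) - q ⬝ᵥ q = - l * (p ⬝ᵥ (G *ᵥ p)) := by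
      field_simp at h
      linarith
    have h4 : 0 ≤ l * (l * (p ⬝ᵥ (G *ᵥ p))) := by positivity
    rw [h3] at hgap
    linarith
  rw [hq, dotProduct_zero] at h
  have h0 : y ⬝ᵥ (P *ᵥ y) = 0 := by linarith
  rw [hpy]
  exact (hP.dotProduct_mulVec_zero_iff y).1 (by simpa using h0)

/-- Follows from the intertwining `P (1 + ΦP) = (1 + PΦ) P` by inverting on both sides. -/
theorem transpose_inv_one_add_mul_mul {Φ : Matrix ι ι ℝ} (hP : Pᵀ = P) (hΦ : Φᵀ = Φ)
    (hu : IsUnit (1 + P * Φ)) : ((1 + P * Φ)⁻¹ * P)ᵀ = (1 + P * Φ)⁻¹ * P := by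
  have hu' := (isUnit_iff_isUnit_det _).1 hu
  have hut : IsUnit ((1 + P * Φ)ᵀ).det := by rwa [det_transpose]
  have ht : (1 + P * Φ)ᵀ = 1 + Φ * P := by simp [transpose_mul, hP, hΦ]
  rw [transpose_mul, transpose_nonsing_inv, hP]
  have hc : P * (1 + P * Φ)ᵀ = (1 + P * Φ) * P := by rw [ht]; noncomm_ring
  calc P * ((1 + P * Φ)ᵀ)⁻¹
      = (1 + P * Φ)⁻¹ * ((1 + P * Φ) * P) * ((1 + P * Φ)ᵀ)⁻¹ := by
        rw [nonsing_inv_mul_cancel_left _ _ hu']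
    _ = (1 + P * Φ)⁻¹ * P := by
        rw [← hc, mul_assoc, mul_nonsing_inv_cancel_right _ _ hut]

theorem posSemidef_inv_one_add_mul_mul (hP : P.PosSemidef) (hG : G.PosSemidef) (hl : 0 < l)
    (hS : (l • (1 : Matrix κ κ ℝ) - Ξᵀ * P * Ξ).PosDef) :
    ((1 + P * (G - (1 / l) • (Ξ * Ξᵀ)))⁻¹ * P).PosSemidef := by
  have hu := isUnit_one_add_mul hP hG hl hS
  have hu' := (isUnit_iff_isUnit_det _).1 hu
  refine .of_dotProduct_mulVec_nonneg ?_ fun x => ?_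
  · rw [IsHermitian, conjTranspose_eq_transpose_of_trivial]
    exact transpose_inv_one_add_mul_mul hP.transpose_eq
      (by simp [transpose_mul, hG.transpose_eq]) hu
  · obtain ⟨y, hpy, h⟩ := dotProduct_costate (G := G) (Ξ := Ξ) (l := l) x
      (((1 + P * (G - (1 / l) • (Ξ * Ξᵀ)))⁻¹ * P) *ᵥ x)
      (by rw [mulVec_mulVec, mul_nonsing_inv_cancel_left _ _ hu'])
    rw [star_trivial, h]
    set p := ((1 + P * (G - (1 / l) • (Ξ * Ξᵀ)))⁻¹ * P) *ᵥ x
    have hgap := quadForm_sub_gap (Ξ := Ξ) (l := l) hP y (Ξᵀ *ᵥ p) (by rw [hpy])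
    have h1 := hS.posSemidef.dotProduct_nonneg (Ξᵀ *ᵥ p)
    have h2 := hG.dotProduct_nonneg p
    have h3 : 0 ≤ l * (y ⬝ᵥ (P *ᵥ y)) - (Ξᵀ *ᵥ p) ⬝ᵥ (Ξᵀ *ᵥ p) :=
      nonneg_of_mul_nonneg_right (h1.trans hgap) hl
    have h4 : 0 ≤ y ⬝ᵥ (P *ᵥ y) - (1 / l) * ((Ξᵀ *ᵥ p) ⬝ᵥ (Ξᵀ *ᵥ p)) := by
      have := div_nonneg h3 hl.le
      rwa [sub_div, mul_div_cancel_left₀ _ hl.ne', ← one_div_mul_eq_div] at this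
    linarith

theorem isUnit_one_sub_smul_of_isUnit_smul_sub {H : Matrix κ κ ℝ} (hl : 0 < l)
    (h : IsUnit (l • (1 : Matrix κ κ ℝ) - H)) : IsUnit (1 - (1 / l) • H) := by
  have : (1 - (1 / l) • H) = (1 / l) • (l • (1 : Matrix κ κ ℝ) - H) := by
    rw [smul_sub, smul_smul, one_div_mul_cancel hl.ne', one_smul]
  rw [this, isUnit_iff_isUnit_det, det_smul]
  exact ((isUnit_iff_ne_zero.2 (by positivity)).pow _).mul ((isUnit_iff_isUnit_det _).1 h)

/-- Sylvester's identity `det (1 - XY) = det (1 - YX)`. -/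
theorem isUnit_one_sub_smul_mul_mul_transpose
    (h : IsUnit (1 - (1 / l) • (Ξᵀ * P * Ξ))) : IsUnit (1 - (1 / l) • (P * Ξ * Ξᵀ)) := by
  rw [isUnit_iff_isUnit_det] at h ⊢
  rwa [← smul_mul, det_one_sub_mul_comm, Matrix.mul_smul, ← Matrix.mul_assoc]

/-- The push-through identity. -/
theorem transpose_mul_inv_one_sub_mul
    (h : IsUnit (1 - (1 / l) • (Ξᵀ * P * Ξ))) :
    Ξᵀ * (1 - (1 / l) • (P * Ξ * Ξᵀ))⁻¹ = (1 - (1 / l) • (Ξᵀ * P * Ξ))⁻¹ * Ξᵀ := by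
  have h' := (isUnit_iff_isUnit_det _).1 (isUnit_one_sub_smul_mul_mul_transpose h)
  have hd := (isUnit_iff_isUnit_det _).1 h
  have hc : (1 - (1 / l) • (Ξᵀ * P * Ξ)) * Ξᵀ = Ξᵀ * (1 - (1 / l) • (P * Ξ * Ξᵀ)) := by
    simp [Matrix.sub_mul, Matrix.mul_sub, Matrix.mul_assoc]
  calc Ξᵀ * (1 - (1 / l) • (P * Ξ * Ξᵀ))⁻¹
      = (1 - (1 / l) • (Ξᵀ * P * Ξ))⁻¹ * ((1 - (1 / l) • (Ξᵀ * P * Ξ)) * Ξᵀ)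
          * (1 - (1 / l) • (P * Ξ * Ξᵀ))⁻¹ := by
        rw [nonsing_inv_mul_cancel_left _ _ hd]
    _ = _ := by rw [hc, Matrix.mul_assoc, mul_nonsing_inv_cancel_right _ _ h']

end Algebra

/-! ### Integration against uniform measures on finitely many points -/

section Uniform

variable {α E : Type*} [MeasurableSpace α] {N : ℕ} (p : Fin N → α)

theorem lintegral_uniform {f : α → ℝ≥0∞} (hf : Measurable f) :
    ∫⁻ a, f a ∂((N : ℝ≥0∞)⁻¹ • ∑ i, Measure.dirac (p i)) = (N : ℝ≥0∞)⁻¹ * ∑ i, f (p i) := by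
  rw [lintegral_smul_measure, lintegral_finsetSum_measure, smul_eq_mul]
  simp_rw [lintegral_dirac' _ hf]

theorem integral_uniform [MeasurableSingletonClass α] [NormedAddCommGroup E] [NormedSpace ℝ E]
    [CompleteSpace E] (f : α → E) :
    ∫ a, f a ∂((N : ℝ≥0∞)⁻¹ • ∑ i, Measure.dirac (p i)) = (N : ℝ)⁻¹ • ∑ i, f (p i) := by
  rw [integral_smul_measure, integral_finsetSum_measure fun i _ => integrable_dirac (by simp)]
  simp [ENNReal.toReal_inv]

theorem integrable_uniform [MeasurableSingletonClass α] [NeZero N] (f : α → ℝ) :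
    Integrable f ((N : ℝ≥0∞)⁻¹ • ∑ i, Measure.dirac (p i)) := by
  have hN : (N : ℝ≥0∞)⁻¹ ≠ ∞ := by simp [NeZero.ne N]
  have h : Integrable f (∑ i, Measure.dirac (p i)) :=
    integrable_finsetSum_measure.2 fun i _ => integrable_dirac (by simp)
  exact h.smul_measure hN

end Uniform

/-! ### The one-stage saddle point -/

namespace LQData

variable {n m k N : ℕ} (d : LQData n m k N)

theorem mean_eq (t : ℕ) : d.mean t = (N : ℝ)⁻¹ • ∑ i, d.sample t i :=
  integral_uniform _ _

theorem secondMoment_eq (t : ℕ) :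
    d.secondMoment t = (N : ℝ)⁻¹ • ∑ i, vecMulVec (d.sample t i) (d.sample t i) := by
  ext a b
  simp only [secondMoment, empirical, of_apply]
  rw [integral_uniform]
  simp [Matrix.sum_apply, vecMulVec_apply]

theorem trace_mul_secondMoment (t : ℕ) (X : Matrix (Fin k) (Fin k) ℝ) :
    (X * d.secondMoment t).trace =
      (N : ℝ)⁻¹ * ∑ i, d.sample t i ⬝ᵥ (X *ᵥ d.sample t i) := by
  rw [secondMoment_eq, Matrix.mul_smul, trace_smul, Matrix.mul_sum, trace_sum, smul_eq_mul]
  simp_rw [mul_vecMulVec, trace_vecMulVec, dotProduct_comm]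

/-- The quadratic function `x ↦ xᵀ P_t x + 2 r_tᵀ x + z_t`. -/
noncomputable def quadValue (t : ℕ) (x : Fin n → ℝ) : ℝ :=
  x ⬝ᵥ (d.P t *ᵥ x) + 2 * (d.r t ⬝ᵥ x) + d.z t

/-- The successor of the state `x` under the input `u` and the disturbance `w`. -/
def next (x : Fin n → ℝ) (u : Fin m → ℝ) (w : Fin k → ℝ) : Fin n → ℝ :=
  d.A *ᵥ x + d.B *ᵥ u + d.Ξ *ᵥ w

/-- The matrix `λ I - Ξᵀ P_{t+1} Ξ`. -/
noncomputable def gapMatrix (t : ℕ) : Matrix (Fin k) (Fin k) ℝ :=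
  d.lam • (1 : Matrix (Fin k) (Fin k) ℝ) - d.Ξᵀ * d.P (t + 1) * d.Ξ

/-- The opponent's best response to the affine policy, for the sample point `w`. -/
noncomputable def worst (t : ℕ) (w : Fin k → ℝ) (x : Fin n → ℝ) : Fin k → ℝ :=
  (d.gapMatrix t)⁻¹ *ᵥ
    ((d.Ξᵀ * d.P (t + 1)) *ᵥ
        (d.A *ᵥ x + d.B *ᵥ (d.K t *ᵥ x) + d.B *ᵥ d.L t)
      + d.Ξᵀ *ᵥ d.r (t + 1) + d.lam • w)

/-- The costate `P_{t+1} y + r_{t+1}` at the mean successor `y` of `x`. -/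
noncomputable def costate (t : ℕ) (x : Fin n → ℝ) : Fin n → ℝ :=
  (1 + d.P (t + 1) * d.Φ)⁻¹ *ᵥ
    (d.P (t + 1) *ᵥ (d.A *ᵥ x + d.Ξ *ᵥ d.mean t) + d.r (t + 1))

/-- The conditions under which stage `t` of the minimax problem has a saddle point. -/
structure Regular (t : ℕ) : Prop where
  lam_pos : 0 < d.lam
  R_posDef : d.R.PosDef
  P_posSemidef : (d.P (t + 1)).PosSemidef
  gap_posDef : (d.gapMatrix t).PosDef

theorem transpose_Φ (hR : d.R.PosDef) : d.Φᵀ = d.Φ := by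
  have : (d.R⁻¹)ᵀ = d.R⁻¹ := hR.inv.posSemidef.transpose_eq
  simp [Φ, transpose_mul, this, Matrix.mul_assoc]

theorem posSemidef_inputWeight (hR : d.R.PosDef) : (d.B * d.R⁻¹ * d.Bᵀ).PosSemidef := by
  simpa using hR.inv.posSemidef.mul_mul_conjTranspose_same d.B

theorem quadValue_add {t : ℕ} (hP : (d.P t).PosSemidef) (y h : Fin n → ℝ) :
    d.quadValue t (y + h) =
      d.quadValue t y + 2 * (h ⬝ᵥ (d.P t *ᵥ y + d.r t)) + h ⬝ᵥ (d.P t *ᵥ h) := by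
  simp only [quadValue, mulVec_add, add_dotProduct, dotProduct_add]
  rw [hP.dotProduct_mulVec_comm y h, dotProduct_comm (d.r t) h]
  ring

namespace Regular

variable {d} {t : ℕ} (h : d.Regular t)
include h

theorem isUnit_one_add : IsUnit (1 + d.P (t + 1) * d.Φ) :=
  isUnit_one_add_mul h.P_posSemidef (d.posSemidef_inputWeight h.R_posDef) h.lam_pos h.gap_posDef

theorem posSemidef_inv_mul : ((1 + d.P (t + 1) * d.Φ)⁻¹ * d.P (t + 1)).PosSemidef :=
  posSemidef_inv_one_add_mul_mul h.P_posSemidef (d.posSemidef_inputWeight h.R_posDef) h.lam_pos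
    h.gap_posDef

theorem isUnit_one_sub : IsUnit (1 - (1 / d.lam) • (d.Ξᵀ * d.P (t + 1) * d.Ξ)) :=
  isUnit_one_sub_smul_of_isUnit_smul_sub h.lam_pos h.gap_posDef.isUnit

theorem one_add_mulVec_costate (x : Fin n → ℝ) :
    (1 + d.P (t + 1) * d.Φ) *ᵥ d.costate t x =
      d.P (t + 1) *ᵥ (d.A *ᵥ x + d.Ξ *ᵥ d.mean t) + d.r (t + 1) := by
  rw [costate, mulVec_mulVec, mul_nonsing_inv _ ((isUnit_iff_isUnit_det _).1 h.isUnit_one_add),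
    one_mulVec]

omit h in
theorem act_eq (x : Fin n → ℝ) :
    d.optPolicy.act t x = -((d.R⁻¹ * d.Bᵀ) *ᵥ d.costate t x) := by
  simp only [optPolicy, K, L, costate, neg_mulVec, mulVec_add, mulVec_mulVec, Matrix.mul_assoc]
  abel

theorem R_mulVec_act (x : Fin n → ℝ) :
    d.R *ᵥ d.optPolicy.act t x = -(d.Bᵀ *ᵥ d.costate t x) := by
  rw [act_eq, mulVec_neg, mulVec_mulVec,
    mul_nonsing_inv_cancel_left _ _ ((isUnit_iff_isUnit_det _).1 h.R_posDef.isUnit)]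

theorem gapMatrix_mulVec_worst (w : Fin k → ℝ) (x : Fin n → ℝ) :
    d.gapMatrix t *ᵥ d.worst t w x =
      d.Ξᵀ *ᵥ (d.P (t + 1) *ᵥ (d.A *ᵥ x + d.B *ᵥ d.optPolicy.act t x) + d.r (t + 1))
        + d.lam • w := by
  rw [worst, mulVec_mulVec, mul_nonsing_inv _ ((isUnit_iff_isUnit_det _).1 h.gap_posDef.isUnit),
    one_mulVec]
  simp only [optPolicy, mulVec_add, mulVec_mulVec, Matrix.mul_assoc]
  abel

/-- The right side is the first-order condition for maximising the next value minus `λ|w' - w|²`. It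
is implicit in `w'`; collecting the terms in `w'` produces `gapMatrix`, which is invertible. -/
theorem eq_worst_iff (w w' : Fin k → ℝ) (x : Fin n → ℝ) :
    w' = d.worst t w x ↔ d.lam • (w' - w) =
      d.Ξᵀ *ᵥ (d.P (t + 1) *ᵥ d.next x (d.optPolicy.act t x) w' + d.r (t + 1)) := by
  have hinj := mulVec_injective_iff_isUnit.2 h.gap_posDef.isUnit
  rw [← hinj.eq_iff, h.gapMatrix_mulVec_worst]
  simp only [gapMatrix, next, sub_mulVec, smul_mulVec, one_mulVec, mulVec_add, ← mulVec_mulVec,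
    smul_sub]
  constructor <;> intro H
  · rw [sub_eq_iff_eq_add] at H ⊢
    rw [H]; abel
  · rw [sub_eq_iff_eq_add] at H ⊢
    rw [H]; abel

theorem lam_smul_worst_sub (w : Fin k → ℝ) (x : Fin n → ℝ) :
    d.lam • (d.worst t w x - w) = d.Ξᵀ *ᵥ
      (d.P (t + 1) *ᵥ d.next x (d.optPolicy.act t x) (d.worst t w x) + d.r (t + 1)) :=
  (h.eq_worst_iff w _ x).1 rfl

omit h in
theorem next_mean_add (x : Fin n → ℝ) :
    d.next x (d.optPolicy.act t x) (d.mean t + (1 / d.lam) • (d.Ξᵀ *ᵥ d.costate t x)) =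
      d.A *ᵥ x + d.Ξ *ᵥ d.mean t - d.Φ *ᵥ d.costate t x := by
  rw [next, act_eq, Φ]
  simp only [mulVec_neg, mulVec_add, sub_mulVec, smul_mulVec, mulVec_smul, ← mulVec_mulVec]
  abel

/-- Solves the circular dependence between costate and successor: `(1 + PΦ)p = Pa + r` rearranges to
`P(a - Φp) + r = p`. -/
theorem P_mulVec_next_mean_add (x : Fin n → ℝ) :
    d.P (t + 1) *ᵥ d.next x (d.optPolicy.act t x)
      (d.mean t + (1 / d.lam) • (d.Ξᵀ *ᵥ d.costate t x)) + d.r (t + 1) = d.costate t x := by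
  have := h.one_add_mulVec_costate x
  rw [add_mulVec, one_mulVec, ← mulVec_mulVec] at this
  rw [next_mean_add, mulVec_sub, sub_add_eq_add_sub, ← this, add_sub_cancel_right]

theorem worst_mean (x : Fin n → ℝ) :
    d.worst t (d.mean t) x = d.mean t + (1 / d.lam) • (d.Ξᵀ *ᵥ d.costate t x) := by
  symm
  rw [h.eq_worst_iff, h.P_mulVec_next_mean_add, add_sub_cancel_left, smul_smul,
    mul_one_div_cancel h.lam_pos.ne', one_smul]

omit h in
theorem worst_add (w e : Fin k → ℝ) (x : Fin n → ℝ) :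
    d.worst t (w + e) x = d.worst t w x + d.lam • ((d.gapMatrix t)⁻¹ *ᵥ e) := by
  simp only [worst, mulVec_add, mulVec_smul, smul_add]
  abel

omit h in
theorem worst_eq (w : Fin k → ℝ) (x : Fin n → ℝ) :
    d.worst t w x = d.worst t 0 x + d.lam • ((d.gapMatrix t)⁻¹ *ᵥ w) := by
  rw [← worst_add, zero_add]

-- The response is affine in the sample, so it commutes with averaging.
omit h in
theorem average_worst [NeZero N] (x : Fin n → ℝ) :
    (N : ℝ)⁻¹ • ∑ i, d.worst t (d.sample t i) x = d.worst t (d.mean t) x := by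
  have hN : (N : ℝ) ≠ 0 := Nat.cast_ne_zero.2 (NeZero.ne N)
  rw [worst_eq (d.mean t), mean_eq]
  simp_rw [worst_eq (d.sample t _) x]
  rw [Finset.sum_add_distrib, smul_add, ← Finset.smul_sum, ← mulVec_sum, mulVec_smul]
  congr 1
  · rw [Finset.sum_const, Finset.card_univ, Fintype.card_fin, ← Nat.cast_smul_eq_nsmul ℝ, smul_smul,
      inv_mul_cancel₀ hN, one_smul]
  · rw [smul_comm]

/-- The value of the opponent's stage problem at the best response to the sample point `w`. -/
theorem quadValue_next_sub_le (x : Fin n → ℝ) (w w' : Fin k → ℝ) :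
    d.quadValue (t + 1) (d.next x (d.optPolicy.act t x) w') - d.lam * ((w' - w) ⬝ᵥ (w' - w)) ≤
      d.quadValue (t + 1) (d.next x (d.optPolicy.act t x) (d.worst t w x))
        - d.lam * ((d.worst t w x - w) ⬝ᵥ (d.worst t w x - w)) := by
  have hw := h.lam_smul_worst_sub w x
  set ws := d.worst t w x
  set y := d.next x (d.optPolicy.act t x) ws with hy
  obtain ⟨e, rfl⟩ : ∃ e, w' = ws + e := ⟨w' - ws, by abel⟩
  have h1 : d.next x (d.optPolicy.act t x) (ws + e) = y + d.Ξ *ᵥ e := by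
    rw [hy, next, next, mulVec_add]; abel
  have h2 := h.gap_posDef.posSemidef.dotProduct_nonneg e
  rw [gapMatrix, sub_mulVec, dotProduct_sub, dotProduct_transpose_mul_mul_mulVec, smul_mulVec,
    one_mulVec, dotProduct_smul, smul_eq_mul] at h2
  -- The first-order condition at `ws` cancels the terms linear in `e`; what remains is minus the
  -- `gapMatrix` form of `e`.
  have h3 : (d.Ξ *ᵥ e) ⬝ᵥ (d.P (t + 1) *ᵥ y + d.r (t + 1)) = d.lam * (e ⬝ᵥ (ws - w)) := by
    rw [← transpose_transpose d.Ξ, ← dotProduct_mulVec_eq_transpose_mulVec_dotProduct, ← hw,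
      dotProduct_smul, smul_eq_mul]
  have h4 : ws + e - w = (ws - w) + e := by abel
  rw [h1, d.quadValue_add h.P_posSemidef, h3, h4]
  simp only [add_dotProduct, dotProduct_add]
  rw [dotProduct_comm (ws - w) e]
  linarith

/-- The excess stage cost of an input `u`, if the opponent sticks to the worst-case policy. -/
theorem stage_cost_eq [NeZero N] (x : Fin n → ℝ) (u : Fin m → ℝ) :
    u ⬝ᵥ (d.R *ᵥ u)
        + (N : ℝ)⁻¹ * ∑ i, d.quadValue (t + 1) (d.next x u (d.worst t (d.sample t i) x)) =
      d.optPolicy.act t x ⬝ᵥ (d.R *ᵥ d.optPolicy.act t x)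
        + (N : ℝ)⁻¹ * ∑ i, d.quadValue (t + 1)
          (d.next x (d.optPolicy.act t x) (d.worst t (d.sample t i) x))
        + (u - d.optPolicy.act t x) ⬝ᵥ
          ((d.R + d.Bᵀ * d.P (t + 1) * d.B) *ᵥ (u - d.optPolicy.act t x)) := by
  have hN : (N : ℝ) ≠ 0 := Nat.cast_ne_zero.2 (NeZero.ne N)
  have hR := h.R_mulVec_act x
  have hp := h.P_mulVec_next_mean_add x
  rw [← h.worst_mean] at hp
  set us := d.optPolicy.act t x
  obtain ⟨e, rfl⟩ : ∃ e, u = us + e := ⟨u - us, by abel⟩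
  have h1 : ∀ w, d.next x (us + e) w = d.next x us w + d.B *ᵥ e := fun w => by
    rw [next, next, mulVec_add]; abel
  have havg : (N : ℝ)⁻¹ • ∑ i, d.next x us (d.worst t (d.sample t i) x) =
      d.next x us (d.worst t (d.mean t) x) := by
    rw [← average_worst]
    simp only [next]
    rw [Finset.sum_add_distrib, smul_add, mulVec_smul, mulVec_sum, Finset.sum_const,
      Finset.card_univ, Fintype.card_fin, ← Nat.cast_smul_eq_nsmul ℝ, smul_smul,
      inv_mul_cancel₀ hN, one_smul]
  -- The averaged gradient of the next value is the costate, so this linear term cancels the one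
  -- from the input cost, where `R u = -Bᵀp`.
  have hlin : (N : ℝ)⁻¹ * ∑ i, (d.B *ᵥ e) ⬝ᵥ (d.P (t + 1) *ᵥ
      d.next x us (d.worst t (d.sample t i) x) + d.r (t + 1)) = e ⬝ᵥ (d.Bᵀ *ᵥ d.costate t x) := by
    rw [dotProduct_mulVec_eq_transpose_mulVec_dotProduct, transpose_transpose, ← hp, ← havg,
      mulVec_smul, mulVec_sum]
    simp_rw [dotProduct_add]
    rw [Finset.sum_add_distrib, mul_add, dotProduct_smul, dotProduct_sum, smul_eq_mul,
      Finset.sum_const, Finset.card_univ, Fintype.card_fin, nsmul_eq_mul, inv_mul_cancel_left₀ hN]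
  simp_rw [h1, d.quadValue_add h.P_posSemidef]
  rw [Finset.sum_add_distrib, Finset.sum_add_distrib, ← Finset.mul_sum, Finset.sum_const,
    Finset.card_univ, Fintype.card_fin, nsmul_eq_mul, mul_add, mul_add, inv_mul_cancel_left₀ hN,
    mul_left_comm (N : ℝ)⁻¹ 2, hlin, add_sub_cancel_left, add_mulVec, dotProduct_add,
    dotProduct_transpose_mul_mul_mulVec]
  simp only [mulVec_add, dotProduct_add, add_dotProduct]
  rw [h.R_posDef.posSemidef.dotProduct_mulVec_comm us e, hR]
  simp only [dotProduct_neg]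
  ring

/-- Moment matrix of the worst-case dispersion. -/
theorem inv_one_sub_mul_eq :
    (1 - (1 / d.lam) • (d.Ξᵀ * d.P (t + 1) * d.Ξ))⁻¹ * d.Ξᵀ * d.P (t + 1) * d.Ξ =
      d.lam • (d.lam • (d.gapMatrix t)⁻¹ - 1) := by
  have hS := (isUnit_iff_isUnit_det _).1 h.gap_posDef.isUnit
  have hl := h.lam_pos.ne'
  have hH : d.Ξᵀ * d.P (t + 1) * d.Ξ = d.lam • (1 : Matrix (Fin k) (Fin k) ℝ) - d.gapMatrix t := by
    simp [gapMatrix]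
  have h1 : 1 - (1 / d.lam) • (d.Ξᵀ * d.P (t + 1) * d.Ξ) = (1 / d.lam) • d.gapMatrix t := by
    rw [hH, smul_sub, smul_smul, one_div_mul_cancel hl, one_smul, sub_sub_cancel]
  have h2 : ((1 / d.lam) • d.gapMatrix t)⁻¹ = d.lam • (d.gapMatrix t)⁻¹ := by
    refine inv_eq_left_inv ?_
    rw [smul_mul_smul_comm, mul_one_div_cancel hl, one_smul, nonsing_inv_mul _ hS]
  rw [h1, h2, Matrix.mul_assoc, Matrix.mul_assoc, ← Matrix.mul_assoc d.Ξᵀ, hH, Matrix.smul_mul,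
    Matrix.mul_sub, nonsing_inv_mul _ hS, Matrix.mul_smul, Matrix.mul_one]

/-- Separates the value at the mean from the effect of a deviation `e`. After averaging over the
samples the linear term disappears and the quadratic term gives the dispersion part of `z`. -/
theorem quadValue_worst_add (x : Fin n → ℝ) (e : Fin k → ℝ) :
    d.quadValue (t + 1) (d.next x (d.optPolicy.act t x) (d.worst t (d.mean t + e) x))
        - d.lam * ((d.worst t (d.mean t + e) x - (d.mean t + e)) ⬝ᵥ
          (d.worst t (d.mean t + e) x - (d.mean t + e))) =
      d.quadValue (t + 1) (d.A *ᵥ x + d.Ξ *ᵥ d.mean t - d.Φ *ᵥ d.costate t x)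
        - (1 / d.lam) * ((d.Ξᵀ *ᵥ d.costate t x) ⬝ᵥ (d.Ξᵀ *ᵥ d.costate t x))
        + 2 * (e ⬝ᵥ (d.Ξᵀ *ᵥ d.costate t x))
        + e ⬝ᵥ ((d.lam • (d.lam • (d.gapMatrix t)⁻¹ - 1)) *ᵥ e) := by
  have hl := h.lam_pos.ne'
  have hS := (isUnit_iff_isUnit_det _).1 h.gap_posDef.isUnit
  have hp := h.P_mulVec_next_mean_add x
  rw [next_mean_add] at hp
  have hy : d.next x (d.optPolicy.act t x) (d.worst t (d.mean t + e) x) =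
      (d.A *ᵥ x + d.Ξ *ᵥ d.mean t - d.Φ *ᵥ d.costate t x) +
        d.Ξ *ᵥ (d.lam • ((d.gapMatrix t)⁻¹ *ᵥ e)) := by
    rw [worst_add, h.worst_mean, ← next_mean_add, next, next, mulVec_add]; abel
  rw [hy, worst_add, h.worst_mean, d.quadValue_add h.P_posSemidef, hp]
  have hf : (d.gapMatrix t) *ᵥ ((d.gapMatrix t)⁻¹ *ᵥ e) = e := by
    rw [mulVec_mulVec, mul_nonsing_inv _ hS, one_mulVec]
  rw [smul_mulVec, sub_mulVec, smul_mulVec, one_mulVec]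
  set f := (d.gapMatrix t)⁻¹ *ᵥ e
  set q := d.Ξᵀ *ᵥ d.costate t x with hq
  have h1 : (d.Ξ *ᵥ (d.lam • f)) ⬝ᵥ d.costate t x = d.lam * (f ⬝ᵥ q) := by
    rw [hq, dotProduct_mulVec_eq_transpose_mulVec_dotProduct, transpose_transpose, mulVec_smul,
      smul_dotProduct, smul_eq_mul]
  have h2 : (d.Ξ *ᵥ (d.lam • f)) ⬝ᵥ (d.P (t + 1) *ᵥ (d.Ξ *ᵥ (d.lam • f))) =
      d.lam ^ 2 * (d.lam * (f ⬝ᵥ f) - f ⬝ᵥ e) := by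
    have := congrArg (fun v => f ⬝ᵥ v) hf
    simp only [gapMatrix, sub_mulVec, dotProduct_sub, dotProduct_transpose_mul_mul_mulVec,
      smul_mulVec, one_mulVec, dotProduct_smul, smul_eq_mul] at this
    simp only [mulVec_smul, smul_dotProduct, dotProduct_smul, smul_eq_mul]
    rw [← this]; ring
  have h3 : d.mean t + (1 / d.lam) • q + d.lam • f - (d.mean t + e) =
      (1 / d.lam) • q + d.lam • f - e := by abel
  rw [h1, h2, h3]
  simp only [add_dotProduct, dotProduct_add, sub_dotProduct, dotProduct_sub, smul_dotProduct,
    dotProduct_smul, smul_eq_mul]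
  rw [dotProduct_comm q f, dotProduct_comm q e, dotProduct_comm e f]
  field_simp
  ring

/-- The minimax value of the deterministic part of the stage problem. -/
theorem stage_value_mean (ht : t < d.T) (x : Fin n → ℝ) :
    x ⬝ᵥ (d.Q *ᵥ x) + d.optPolicy.act t x ⬝ᵥ (d.R *ᵥ d.optPolicy.act t x)
        + d.quadValue (t + 1) (d.A *ᵥ x + d.Ξ *ᵥ d.mean t - d.Φ *ᵥ d.costate t x)
        - (1 / d.lam) * ((d.Ξᵀ *ᵥ d.costate t x) ⬝ᵥ (d.Ξᵀ *ᵥ d.costate t x))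
        + (((1 - (1 / d.lam) • (d.Ξᵀ * d.P (t + 1) * d.Ξ))⁻¹
          * d.Ξᵀ * d.P (t + 1) * d.Ξ * d.secondMoment t).trace
        - d.mean t ⬝ᵥ (((1 - (1 / d.lam) • (d.Ξᵀ * d.P (t + 1) * d.Ξ))⁻¹
          * d.Ξᵀ * d.P (t + 1) * d.Ξ) *ᵥ d.mean t)) =
      d.quadValue t x := by
  have hΦ := d.transpose_Φ h.R_posDef
  have hu := (isUnit_iff_isUnit_det _).1 h.isUnit_one_add
  have hW := h.posSemidef_inv_mul
  have hp := h.P_mulVec_next_mean_add x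
  rw [next_mean_add] at hp
  -- Input cost and penalty of the mean displacement are the two halves of the quadratic form of `Φ`
  -- at the costate.
  have huR : d.optPolicy.act t x ⬝ᵥ (d.R *ᵥ d.optPolicy.act t x)
      - (1 / d.lam) * ((d.Ξᵀ *ᵥ d.costate t x) ⬝ᵥ (d.Ξᵀ *ᵥ d.costate t x)) =
      d.costate t x ⬝ᵥ (d.Φ *ᵥ d.costate t x) := by
    rw [h.R_mulVec_act, act_eq, neg_dotProduct_neg, Φ, sub_mulVec, dotProduct_sub, smul_mulVec,
      dotProduct_smul, smul_eq_mul]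
    simp only [← mulVec_mulVec]
    rw [dotProduct_mulVec_eq_transpose_mulVec_dotProduct d.Ξ,
      dotProduct_mulVec_eq_transpose_mulVec_dotProduct d.B,
      dotProduct_comm (d.R⁻¹ *ᵥ _)]
  -- Push-through rewrites the second inverse in `z` as the matrix inside the trace, so that the
  -- corresponding mean terms cancel.
  have hpush : d.Ξᵀ * ((1 + d.P (t + 1) * d.Φ)⁻¹
      - (1 - (1 / d.lam) • (d.P (t + 1) * d.Ξ * d.Ξᵀ))⁻¹) * d.P (t + 1) * d.Ξ =
      d.Ξᵀ * ((1 + d.P (t + 1) * d.Φ)⁻¹ * d.P (t + 1)) * d.Ξ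
      - (1 - (1 / d.lam) • (d.Ξᵀ * d.P (t + 1) * d.Ξ))⁻¹ * d.Ξᵀ * d.P (t + 1) * d.Ξ := by
    rw [Matrix.mul_sub, transpose_mul_inv_one_sub_mul h.isUnit_one_sub]
    simp only [Matrix.sub_mul, Matrix.mul_assoc]
  have hcostate : d.costate t x = ((1 + d.P (t + 1) * d.Φ)⁻¹ * d.P (t + 1)) *ᵥ
      (d.A *ᵥ x + d.Ξ *ᵥ d.mean t) + (1 + d.P (t + 1) * d.Φ)⁻¹ *ᵥ d.r (t + 1) := by
    rw [costate, mulVec_add, mulVec_mulVec]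
  have hquad : d.quadValue (t + 1) (d.A *ᵥ x + d.Ξ *ᵥ d.mean t - d.Φ *ᵥ d.costate t x) =
      (d.A *ᵥ x + d.Ξ *ᵥ d.mean t - d.Φ *ᵥ d.costate t x) ⬝ᵥ (d.costate t x + d.r (t + 1))
        + d.z (t + 1) := by
    rw [quadValue, eq_sub_of_add_eq hp, dotProduct_sub, dotProduct_add,
      dotProduct_comm (d.r (t + 1))]
    ring
  have hPt : x ⬝ᵥ (d.P t *ᵥ x) = x ⬝ᵥ (d.Q *ᵥ x) + (d.A *ᵥ x) ⬝ᵥ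
      (((1 + d.P (t + 1) * d.Φ)⁻¹ * d.P (t + 1)) *ᵥ (d.A *ᵥ x)) := by
    rw [d.P_step ht, add_mulVec, dotProduct_add, Matrix.mul_assoc d.Aᵀ,
      dotProduct_transpose_mul_mul_mulVec]
  have hrt : d.r t ⬝ᵥ x = (d.A *ᵥ x) ⬝ᵥ (((1 + d.P (t + 1) * d.Φ)⁻¹ * d.P (t + 1)) *ᵥ
      (d.Ξ *ᵥ d.mean t) + (1 + d.P (t + 1) * d.Φ)⁻¹ *ᵥ d.r (t + 1)) := by
    rw [d.r_step ht, dotProduct_comm, ← mulVec_mulVec,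
      dotProduct_mulVec_eq_transpose_mulVec_dotProduct, transpose_transpose, mulVec_add,
      ← mulVec_mulVec, ← mulVec_mulVec]
  -- Uses symmetry of `(1 + PΦ)⁻¹P` together with `(1 + PΦ)⁻¹PΦ = 1 - (1 + PΦ)⁻¹`.
  have hadj : ∀ a : Fin n → ℝ, d.r (t + 1) ⬝ᵥ (d.Φ *ᵥ
      (((1 + d.P (t + 1) * d.Φ)⁻¹ * d.P (t + 1)) *ᵥ a)) =
      a ⬝ᵥ d.r (t + 1) - a ⬝ᵥ ((1 + d.P (t + 1) * d.Φ)⁻¹ *ᵥ d.r (t + 1)) := fun a => by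
    rw [dotProduct_mulVec_eq_transpose_mulVec_dotProduct, hΦ, hW.dotProduct_mulVec_comm,
      ← dotProduct_sub, mulVec_mulVec]
    congr 1
    have : (1 + d.P (t + 1) * d.Φ)⁻¹ * (1 + d.P (t + 1) * d.Φ) = 1 := nonsing_inv_mul _ hu
    rw [Matrix.mul_add, Matrix.mul_one, ← Matrix.mul_assoc] at this
    rw [eq_sub_iff_add_eq', ← add_mulVec, this, one_mulVec]
  rw [hquad, quadValue, d.z_step ht, hpush, hPt, hrt, sub_mulVec, dotProduct_sub,
    dotProduct_transpose_mul_mul_mulVec, hΦ]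
  set X := (1 - (1 / d.lam) • (d.Ξᵀ * d.P (t + 1) * d.Ξ))⁻¹ * d.Ξᵀ * d.P (t + 1) * d.Ξ
  have hsplit := hadj (d.A *ᵥ x + d.Ξ *ᵥ d.mean t)
  have hr' : d.r (t + 1) ⬝ᵥ (d.Φ *ᵥ d.costate t x) =
      (d.A *ᵥ x + d.Ξ *ᵥ d.mean t) ⬝ᵥ d.r (t + 1)
      - (d.A *ᵥ x + d.Ξ *ᵥ d.mean t) ⬝ᵥ ((1 + d.P (t + 1) * d.Φ)⁻¹ *ᵥ d.r (t + 1))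
      + (d.Φ *ᵥ d.r (t + 1)) ⬝ᵥ ((1 + d.P (t + 1) * d.Φ)⁻¹ *ᵥ d.r (t + 1)) := by
    rw [hcostate, mulVec_add, dotProduct_add, hsplit,
      dotProduct_mulVec_eq_transpose_mulVec_dotProduct d.Φ (d.r (t + 1)) (_ *ᵥ d.r (t + 1)), hΦ]
  have ha : (d.A *ᵥ x + d.Ξ *ᵥ d.mean t) ⬝ᵥ d.costate t x =
      (d.A *ᵥ x + d.Ξ *ᵥ d.mean t) ⬝ᵥ (((1 + d.P (t + 1) * d.Φ)⁻¹ * d.P (t + 1)) *ᵥ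
      (d.A *ᵥ x + d.Ξ *ᵥ d.mean t))
      + (d.A *ᵥ x + d.Ξ *ᵥ d.mean t) ⬝ᵥ ((1 + d.P (t + 1) * d.Φ)⁻¹ *ᵥ d.r (t + 1)) := by
    rw [← dotProduct_add, ← hcostate]
  have hcomm := hW.dotProduct_mulVec_comm (d.Ξ *ᵥ d.mean t) (d.A *ᵥ x)
  rw [sub_dotProduct, dotProduct_add, dotProduct_add, ha, dotProduct_comm (d.Φ *ᵥ _) (d.r (t + 1)),
    hr', dotProduct_comm (d.Φ *ᵥ _) (d.costate t x), ← huR]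
  generalize (1 + d.P (t + 1) * d.Φ)⁻¹ * d.P (t + 1) = W at *
  generalize (1 + d.P (t + 1) * d.Φ)⁻¹ *ᵥ d.r (t + 1) = mr at *
  simp only [add_dotProduct, dotProduct_add, mulVec_add, sub_dotProduct, smul_dotProduct,
    smul_eq_mul]
  rw [hcomm]
  ring

/-- The dynamic programming identity at the saddle point. -/
theorem stage_value [NeZero N] (ht : t < d.T) (x : Fin n → ℝ) :
    x ⬝ᵥ (d.Q *ᵥ x) + d.optPolicy.act t x ⬝ᵥ (d.R *ᵥ d.optPolicy.act t x)
        + (N : ℝ)⁻¹ * ∑ i,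
          (d.quadValue (t + 1) (d.next x (d.optPolicy.act t x) (d.worst t (d.sample t i) x))
          - d.lam * ((d.worst t (d.sample t i) x - d.sample t i) ⬝ᵥ
            (d.worst t (d.sample t i) x - d.sample t i))) =
      d.quadValue t x := by
  have hN : (N : ℝ) ≠ 0 := Nat.cast_ne_zero.2 (NeZero.ne N)
  rw [← h.stage_value_mean ht x, trace_mul_secondMoment, h.inv_one_sub_mul_eq]
  set X := d.lam • (d.lam • (d.gapMatrix t)⁻¹ - 1) with hX
  have hXs : X.IsHermitian := by
    have := h.gap_posDef.inv.isHermitian.eq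
    rw [conjTranspose_eq_transpose_of_trivial] at this
    rw [IsHermitian, hX, conjTranspose_eq_transpose_of_trivial]
    simp [this]
  -- Each sample is written as the mean plus its deviation; the deviations sum to zero.
  have key := fun i : Fin N => h.quadValue_worst_add x (d.sample t i - d.mean t)
  simp only [add_sub_cancel] at key
  simp_rw [key]
  have hsum : ∑ i, d.sample t i = (N : ℝ) • d.mean t := by
    rw [mean_eq, smul_smul, mul_inv_cancel₀ hN, one_smul]
  have hcross : ∀ a b : Fin k → ℝ, a ⬝ᵥ (X *ᵥ b) = b ⬝ᵥ (X *ᵥ a) := fun a b => by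
    have := hXs.eq
    rw [conjTranspose_eq_transpose_of_trivial] at this
    rw [dotProduct_mulVec_eq_transpose_mulVec_dotProduct, this, dotProduct_comm]
  have hquad : ∑ i, (d.sample t i - d.mean t) ⬝ᵥ (X *ᵥ (d.sample t i - d.mean t)) =
      ∑ i, d.sample t i ⬝ᵥ (X *ᵥ d.sample t i) - N * (d.mean t ⬝ᵥ (X *ᵥ d.mean t)) := by
    have : ∀ i, (d.sample t i - d.mean t) ⬝ᵥ (X *ᵥ (d.sample t i - d.mean t)) =
        d.sample t i ⬝ᵥ (X *ᵥ d.sample t i) - 2 * (d.sample t i ⬝ᵥ (X *ᵥ d.mean t))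
          + d.mean t ⬝ᵥ (X *ᵥ d.mean t) := fun i => by
      simp only [mulVec_sub, sub_dotProduct, dotProduct_sub]
      rw [hcross (d.mean t) (d.sample t i)]
      ring
    simp_rw [this]
    rw [Finset.sum_add_distrib, Finset.sum_sub_distrib, ← Finset.mul_sum, ← sum_dotProduct, hsum,
      smul_dotProduct, Finset.sum_const, Finset.card_univ, Fintype.card_fin, nsmul_eq_mul,
      smul_eq_mul]
    ring
  have hlin : ∑ i, (d.sample t i - d.mean t) ⬝ᵥ (d.Ξᵀ *ᵥ d.costate t x) = 0 := by
    rw [← sum_dotProduct, Finset.sum_sub_distrib, hsum, Finset.sum_const, Finset.card_univ,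
      Fintype.card_fin, Nat.cast_smul_eq_nsmul, sub_self, zero_dotProduct]
  rw [Finset.sum_add_distrib, Finset.sum_add_distrib, hquad, ← Finset.mul_sum, hlin,
    Finset.sum_const, Finset.card_univ, Fintype.card_fin, nsmul_eq_mul]
  field_simp
  ring

end Regular

end LQData

/-! ### Square integrability of vector-valued maps -/

section SecondMoments

variable {α : Type*} [MeasurableSpace α] {μ : Measure α} {a b : ℕ}

theorem MeasureTheory.MemLp.mulVec {f : α → Fin a → ℝ} (hf : MemLp f 2 μ)
    (M : Matrix (Fin b) (Fin a) ℝ) : MemLp (fun x => M *ᵥ f x) 2 μ :=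
  (LinearMap.toContinuousLinearMap M.mulVecLin).comp_memLp' hf

theorem MeasureTheory.MemLp.integrable_dotProduct {f g : α → Fin a → ℝ} (hf : MemLp f 2 μ)
    (hg : MemLp g 2 μ) : Integrable (fun x => f x ⬝ᵥ g x) μ :=
  integrable_finsetSum _ fun i _ => (hf.eval i).integrable_mul (hg.eval i)

theorem measurable_dotProduct {f g : α → Fin a → ℝ} (hf : Measurable f) (hg : Measurable g) :
    Measurable fun x => f x ⬝ᵥ g x :=
  Finset.measurable_fun_sum _ fun i _ =>
    ((measurable_pi_apply i).comp hf).mul ((measurable_pi_apply i).comp hg)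

theorem measurable_mulVec {f : α → Fin a → ℝ} (hf : Measurable f)
    (M : Matrix (Fin b) (Fin a) ℝ) : Measurable fun x => M *ᵥ f x :=
  (LinearMap.toContinuousLinearMap M.mulVecLin).measurable.comp hf

theorem memLp_two_of_lintegral_dotProduct_ne_top {f : α → Fin a → ℝ} (hf : Measurable f)
    (h : ∫⁻ x, ENNReal.ofReal (f x ⬝ᵥ f x) ∂μ ≠ ∞) : MemLp f 2 μ := by
  refine memLp_pi_iff.2 fun i => ?_
  have hi : Measurable fun x => f x i := (measurable_pi_apply i).comp hf
  rw [memLp_two_iff_integrable_sq hi.aestronglyMeasurable]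
  refine ⟨(hi.pow_const 2).aestronglyMeasurable, ?_⟩
  rw [hasFiniteIntegral_iff_ofReal (.of_forall fun _ => sq_nonneg _)]
  refine lt_of_le_of_lt (lintegral_mono fun x => ENNReal.ofReal_le_ofReal ?_) h.lt_top
  rw [sq]
  exact Finset.single_le_sum (f := fun i => f x i * f x i) (fun j _ => mul_self_nonneg _)
    (Finset.mem_univ i)

theorem dotProduct_self_nonneg_real (v : Fin a → ℝ) : 0 ≤ v ⬝ᵥ v :=
  Finset.sum_nonneg fun _ _ => mul_self_nonneg _

theorem ofReal_integral_le_lintegral_ofReal {f : α → ℝ} (hf : Integrable f μ) :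
    ENNReal.ofReal (∫ x, f x ∂μ) ≤ ∫⁻ x, ENNReal.ofReal (f x) ∂μ := by
  rw [integral_eq_lintegral_pos_part_sub_lintegral_neg_part hf]
  refine (ENNReal.ofReal_le_ofReal (sub_le_self _ ENNReal.toReal_nonneg)).trans ?_
  exact ENNReal.ofReal_toReal_le

/-- Makes every measurable cost integrable against the worst-case opponent, with no growth condition
on the policy. -/
theorem integrable_of_ae_mem_finset [IsFiniteMeasure μ] {f : α → ℝ} (hf : Measurable f)
    {F : Finset α} (hF : ∀ᵐ x ∂μ, x ∈ F) : Integrable f μ :=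
  Integrable.of_bound hf.aestronglyMeasurable (∑ x ∈ F, ‖f x‖) <| hF.mono fun _ hx =>
    Finset.single_le_sum (f := fun x => ‖f x‖) (fun _ _ => norm_nonneg _) hx

end SecondMoments

/-! ### Bounds on the squared Wasserstein distance -/

section Wasserstein

variable {k : ℕ} {μ ν : Measure (Fin k → ℝ)}

theorem enorm_toLp_sq (v : Fin k → ℝ) :
    ‖WithLp.toLp 2 v‖ₑ ^ 2 = ENNReal.ofReal (v ⬝ᵥ v) := by
  rw [← ofReal_norm, ← ENNReal.ofReal_pow (norm_nonneg _), EuclideanSpace.norm_sq_eq]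
  congr 1
  exact Finset.sum_congr rfl fun i _ => by simp [sq]

theorem rpow_half_sq (a : ℝ≥0∞) : (a ^ (1 / 2 : ℝ)) ^ 2 = a := by
  rw [← ENNReal.rpow_natCast, ← ENNReal.rpow_mul]
  norm_num

theorem wasserstein2_sq_le {η : Measure ((Fin k → ℝ) × (Fin k → ℝ))}
    (h1 : η.map Prod.fst = μ) (h2 : η.map Prod.snd = ν) :
    wasserstein2 μ ν ^ 2 ≤ ∫⁻ p, ENNReal.ofReal ((p.1 - p.2) ⬝ᵥ (p.1 - p.2)) ∂η := by
  rw [← rpow_half_sq (∫⁻ p, _ ∂η)]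
  simp_rw [← enorm_toLp_sq]
  refine pow_le_pow_left' ?_ 2
  unfold wasserstein2
  exact iInf_le_of_le (Subtype.mk η ⟨h1, h2⟩) le_rfl

theorem le_wasserstein2_sq {a : ℝ≥0∞}
    (h : ∀ η : Measure ((Fin k → ℝ) × (Fin k → ℝ)), η.map Prod.fst = μ → η.map Prod.snd = ν →
      a ≤ ∫⁻ p, ENNReal.ofReal ((p.1 - p.2) ⬝ᵥ (p.1 - p.2)) ∂η) :
    a ≤ wasserstein2 μ ν ^ 2 := by
  rw [← rpow_half_sq a]
  refine pow_le_pow_left' (le_iInf fun η => ?_) 2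
  refine ENNReal.rpow_le_rpow ?_ (by norm_num)
  simp_rw [enorm_toLp_sq]
  exact h η.1 η.2.1 η.2.2

theorem measurable_ofReal_dotProduct_self :
    Measurable fun v : Fin k → ℝ => ENNReal.ofReal (v ⬝ᵥ v) :=
  (measurable_dotProduct measurable_id measurable_id).ennreal_ofReal

/-- Integrates `|a|² ≤ 2|a - b|² + 2|b|²` over couplings. A law at finite distance from the samples
therefore has a finite second moment. -/
theorem lintegral_dotProduct_self_le (μ ν : Measure (Fin k → ℝ)) :
    ∫⁻ w, ENNReal.ofReal (w ⬝ᵥ w) ∂μ ≤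
      2 * wasserstein2 μ ν ^ 2 + 2 * ∫⁻ w, ENNReal.ofReal (w ⬝ᵥ w) ∂ν := by
  have hm : Measurable fun p : (Fin k → ℝ) × (Fin k → ℝ) => ENNReal.ofReal (p.2 ⬝ᵥ p.2) :=
    measurable_ofReal_dotProduct_self.comp measurable_snd
  -- Truncated subtraction isolates the distance, so that the infimum over couplings can be taken
  -- without assuming any integral finite.
  have key : (∫⁻ w, ENNReal.ofReal (w ⬝ᵥ w) ∂μ - 2 * ∫⁻ w, ENNReal.ofReal (w ⬝ᵥ w) ∂ν) / 2 ≤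
      wasserstein2 μ ν ^ 2 := by
    refine le_wasserstein2_sq fun η h1 h2 => ENNReal.div_le_of_le_mul' (tsub_le_iff_right.2 ?_)
    rw [← h1, ← h2, lintegral_map measurable_ofReal_dotProduct_self measurable_fst,
      lintegral_map measurable_ofReal_dotProduct_self measurable_snd,
      ← lintegral_const_mul' _ _ (by simp), ← lintegral_const_mul' _ _ (by simp),
      ← lintegral_add_right _ (hm.const_mul _)]
    refine lintegral_mono fun p => ?_
    have h2 : (2 : ℝ≥0∞) = ENNReal.ofReal 2 := by simp
    rw [h2, ← ENNReal.ofReal_mul (by norm_num), ← ENNReal.ofReal_mul (by norm_num),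
      ← ENNReal.ofReal_add (mul_nonneg (by norm_num) (dotProduct_self_nonneg_real _))
        (mul_nonneg (by norm_num) (dotProduct_self_nonneg_real _))]
    refine ENNReal.ofReal_le_ofReal ?_
    -- `2|a - b|² + 2|b|² - |a|² = |a - 2b|²`.
    have := dotProduct_self_nonneg_real (p.1 - (2 : ℝ) • p.2)
    simp only [sub_dotProduct, dotProduct_sub, smul_dotProduct, dotProduct_smul,
      smul_eq_mul] at this ⊢
    linarith
  rw [ENNReal.div_le_iff_le_mul (by simp) (by simp), tsub_le_iff_right] at key
  rwa [mul_comm 2 (_ ^ 2)]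

/-- Weak Kantorovich duality for the quadratic cost. -/
theorem ofReal_integral_sub_integral_le {l : ℝ} (hl : 0 < l)
    {f g : (Fin k → ℝ) → ℝ} (hf : Integrable f μ) (hg : Integrable g ν)
    (hfg : ∀ x y, f x - l * ((x - y) ⬝ᵥ (x - y)) ≤ g y) :
    ENNReal.ofReal (∫ x, f x ∂μ - ∫ y, g y ∂ν) ≤ ENNReal.ofReal l * wasserstein2 μ ν ^ 2 := by
  have hl0 : ENNReal.ofReal l ≠ 0 := by simpa using hl
  rw [mul_comm, ← ENNReal.div_le_iff_le_mul (.inl hl0) (.inl ENNReal.ofReal_ne_top)]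
  refine le_wasserstein2_sq fun η h1 h2 => ENNReal.div_le_of_le_mul' ?_
  subst h1 h2
  have hf' : Integrable (fun p => f p.1) η := hf.comp_measurable measurable_fst
  have hg' : Integrable (fun p => g p.2) η := hg.comp_measurable measurable_snd
  rw [integral_map measurable_fst.aemeasurable hf.aestronglyMeasurable,
    integral_map measurable_snd.aemeasurable hg.aestronglyMeasurable, ← integral_sub hf' hg',
    ← lintegral_const_mul' _ _ ENNReal.ofReal_ne_top]
  refine (ofReal_integral_le_lintegral_ofReal (hf'.sub hg')).trans (lintegral_mono fun p => ?_)
  rw [← ENNReal.ofReal_mul hl.le]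
  refine ENNReal.ofReal_le_ofReal ?_
  have := hfg p.1 p.2
  simp only [Pi.sub_apply]
  linarith

/-- Uses the coupling that pairs points of equal index. -/
theorem wasserstein2_uniform_sq_le {N : ℕ} (p q : Fin N → Fin k → ℝ) :
    wasserstein2 ((N : ℝ≥0∞)⁻¹ • ∑ i, Measure.dirac (p i))
      ((N : ℝ≥0∞)⁻¹ • ∑ i, Measure.dirac (q i)) ^ 2 ≤
      (N : ℝ≥0∞)⁻¹ * ∑ i, ENNReal.ofReal ((p i - q i) ⬝ᵥ (p i - q i)) := by
  have hm : Measurable fun p : (Fin k → ℝ) × (Fin k → ℝ) =>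
      ENNReal.ofReal ((p.1 - p.2) ⬝ᵥ (p.1 - p.2)) :=
    (measurable_dotProduct (measurable_fst.sub measurable_snd)
      (measurable_fst.sub measurable_snd)).ennreal_ofReal
  have := wasserstein2_sq_le
    (η := (N : ℝ≥0∞)⁻¹ • ∑ i, Measure.dirac (p i, q i)) rfl rfl
  rw [lintegral_uniform _ hm] at this
  refine le_of_eq_of_le ?_ this
  have hmap : ∀ f : (Fin k → ℝ) × (Fin k → ℝ) → Fin k → ℝ, Measurable f →
      ((N : ℝ≥0∞)⁻¹ • ∑ i, Measure.dirac (p i, q i)).map f =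
        (N : ℝ≥0∞)⁻¹ • ∑ i, Measure.dirac (f (p i, q i)) := fun f hf => by
    rw [Measure.map_smul, ← Measure.mapₗ_apply_of_measurable hf, map_sum]
    simp_rw [Measure.mapₗ_apply_of_measurable hf, Measure.map_dirac' hf]
  rw [hmap _ measurable_fst, hmap _ measurable_snd]

end Wasserstein

/-! ### Marginal laws of the state process -/

namespace LQData

variable {n m k N : ℕ} (d : LQData n m k N)

instance (π : ControlPolicy n m) (γ : OpponentPolicy n k) (t : ℕ) (x : Fin n → ℝ) :
    IsProbabilityMeasure (d.pathLaw π γ t x) := by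
  unfold pathLaw; infer_instance

/-- The law of the state at time `s` under `(π, γ)` given `x_t = x`. -/
noncomputable def stateLaw (π : ControlPolicy n m) (γ : OpponentPolicy n k) (t : ℕ)
    (x : Fin n → ℝ) (s : ℕ) : Measure (Fin n → ℝ) :=
  (d.pathLaw π γ t x).map fun ω => ω s

instance (π : ControlPolicy n m) (γ : OpponentPolicy n k) (t : ℕ) (x : Fin n → ℝ) (s : ℕ) :
    IsProbabilityMeasure (d.stateLaw π γ t x s) :=
  Measure.isProbabilityMeasure_map (measurable_pi_apply s).aemeasurable

variable (π : ControlPolicy n m) (γ : OpponentPolicy n k) (t : ℕ) (x : Fin n → ℝ)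

theorem stateLaw_eq_map_partialTraj (s : ℕ) :
    d.stateLaw π γ t x s = (Kernel.partialTraj (X := fun _ => Fin n → ℝ) (d.historyStep π γ) t s
      (fun _ => x)).map fun h => h ⟨s, Finset.mem_Iic.2 le_rfl⟩ := by
  rw [← Kernel.traj_map_frestrictLe_apply, Measure.map_map (measurable_pi_apply _) (by fun_prop)]
  rfl

theorem stateLaw_self : d.stateLaw π γ t x t = Measure.dirac x := by
  rw [stateLaw_eq_map_partialTraj, Kernel.partialTraj_self, Kernel.id_apply,
    Measure.map_dirac' (measurable_pi_apply _)]

/-- The history kernel reads only the last coordinate, so the marginals evolve by the one-step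
kernels. -/
theorem stateLaw_succ_eq_bind {s : ℕ} (hs : t ≤ s) :
    d.stateLaw π γ t x (s + 1) = (d.stateLaw π γ t x s).bind (d.step π γ s) := by
  rw [stateLaw_eq_map_partialTraj, stateLaw_eq_map_partialTraj,
    Kernel.partialTraj_succ_eq_comp hs, Kernel.comp_apply, Measure.map_comp _ _ (by fun_prop),
    Kernel.map_partialTraj_succ_self]
  ext A hA
  rw [Measure.bind_apply hA (Kernel.aemeasurable _), Measure.bind_apply hA (Kernel.aemeasurable _),
    lintegral_map (Kernel.measurable_coe _ hA) (measurable_pi_apply _)]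
  rfl

theorem stateLaw_succ {s : ℕ} (hs : t ≤ s) :
    haveI := γ.markov s
    d.stateLaw π γ t x (s + 1) = (d.stateLaw π γ t x s ⊗ₘ γ.law s).map
      fun p => d.next p.1 (π.act s p.1) p.2 := by
  have := γ.markov s
  have hm : Measurable fun p : (Fin n → ℝ) × (Fin k → ℝ) => d.next p.1 (π.act s p.1) p.2 :=
    d.measurable_next π s
  rw [stateLaw_succ_eq_bind _ _ _ _ _ hs, Measure.compProd_eq_comp_prod, Measure.map_comp _ _ hm]
  rfl

end LQData

/-! ### Comparing cost minus penalty with real numbers -/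

theorem ereal_ofReal_sub_le {a v : ℝ} {p : ℝ≥0∞} (ha : 0 ≤ a) (h : ENNReal.ofReal (a - v) ≤ p) :
    ((ENNReal.ofReal a : ℝ≥0∞) : EReal) - (p : EReal) ≤ (v : EReal) := by
  induction p with
  | top => simp
  | coe p =>
    rw [EReal.coe_ennreal_ofReal, max_eq_left ha]
    rw [← ENNReal.ofReal_coe_nnreal, ENNReal.ofReal_le_ofReal_iff p.coe_nonneg] at h
    have : ((p : ℝ≥0∞) : EReal) = ((p : ℝ) : EReal) := rfl
    rw [this, ← EReal.coe_sub, EReal.coe_le_coe_iff]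
    linarith

theorem le_ereal_ofReal_sub {a b : ℝ} {p : ℝ≥0∞} (ha : 0 ≤ a) (hb : 0 ≤ b)
    (h : p ≤ ENNReal.ofReal b) :
    ((a - b : ℝ) : EReal) ≤ ((ENNReal.ofReal a : ℝ≥0∞) : EReal) - (p : EReal) := by
  have h' : (p : EReal) ≤ (b : EReal) := by
    have := EReal.coe_ennreal_le_coe_ennreal_iff.2 h
    rwa [EReal.coe_ennreal_ofReal, max_eq_left hb] at this
  rw [EReal.coe_ennreal_ofReal, max_eq_left ha, EReal.coe_sub]
  exact EReal.sub_le_sub le_rfl h'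

/-! ### Stage gains and the telescoping of the expected cost -/

namespace LQData

variable {n m k N : ℕ} (d : LQData n m k N)

theorem quadValue_last (x : Fin n → ℝ) : d.quadValue d.T x = x ⬝ᵥ (d.Qf *ᵥ x) := by
  simp [quadValue, P_last, r_last, z_last]

theorem measurable_quadValue (s : ℕ) : Measurable (d.quadValue s) :=
  ((measurable_dotProduct measurable_id (measurable_mulVec measurable_id _)).add
    ((measurable_dotProduct measurable_const measurable_id).const_mul 2)).add_const _

theorem integrable_quadValue_comp {α : Type*} [MeasurableSpace α] {μ : Measure α}
    [IsFiniteMeasure μ] {f : α → Fin n → ℝ} (hf : MemLp f 2 μ) (s : ℕ) :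
    Integrable (fun a => d.quadValue s (f a)) μ :=
  ((hf.integrable_dotProduct (hf.mulVec _)).add
    (((memLp_const _).integrable_dotProduct hf).const_mul 2)).add (integrable_const _)

/-- The cost of stage `s`. -/
noncomputable def stageCost (π : ControlPolicy n m) (s : ℕ) (y : Fin n → ℝ) : ℝ :=
  y ⬝ᵥ (d.Q *ᵥ y) + π.act s y ⬝ᵥ (d.R *ᵥ π.act s y)

/-- Stage cost plus expected increase of `quadValue` over stage `s`. -/
noncomputable def stageGain (π : ControlPolicy n m) (γ : OpponentPolicy n k) (s : ℕ)
    (y : Fin n → ℝ) : ℝ :=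
  d.stageCost π s y + ∫ w, d.quadValue (s + 1) (d.next y (π.act s y) w) ∂γ.law s y
    - d.quadValue s y

variable (π : ControlPolicy n m) (γ : OpponentPolicy n k)

theorem measurable_stageCost (s : ℕ) : Measurable (d.stageCost π s) :=
  (measurable_dotProduct measurable_id (measurable_mulVec measurable_id _)).add
    (measurable_dotProduct (π.measurable_act s) (measurable_mulVec (π.measurable_act s) _))

theorem stageCost_nonneg (hQ : d.Q.PosSemidef) (hR : d.R.PosDef) (s : ℕ) (y : Fin n → ℝ) :
    0 ≤ d.stageCost π s y :=
  add_nonneg (hQ.dotProduct_nonneg y) (hR.posSemidef.dotProduct_nonneg _)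

theorem quadCost_eq (t : ℕ) (ω : ℕ → Fin n → ℝ) :
    d.quadCost π t ω = ∑ s ∈ Finset.Ico t d.T, d.stageCost π s (ω s) + d.quadValue d.T (ω d.T) := by
  rw [quadValue_last]; rfl

theorem quadCost_nonneg (hQ : d.Q.PosSemidef) (hQf : d.Qf.PosSemidef) (hR : d.R.PosDef)
    (t : ℕ) (ω : ℕ → Fin n → ℝ) : 0 ≤ d.quadCost π t ω := by
  rw [quadCost_eq, quadValue_last]
  exact add_nonneg (Finset.sum_nonneg fun s _ => d.stageCost_nonneg π hQ hR s _)
    (hQf.dotProduct_nonneg _)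

variable {d π γ} {t : ℕ} {x : Fin n → ℝ}

theorem integrable_comp_eval {f : (Fin n → ℝ) → ℝ} {s : ℕ}
    (hf : Integrable f (d.stateLaw π γ t x s)) :
    Integrable (fun ω => f (ω s)) (d.pathLaw π γ t x) :=
  hf.comp_measurable (measurable_pi_apply s)

theorem integral_comp_eval {f : (Fin n → ℝ) → ℝ} {s : ℕ}
    (hf : Integrable f (d.stateLaw π γ t x s)) :
    ∫ ω, f (ω s) ∂d.pathLaw π γ t x = ∫ y, f y ∂d.stateLaw π γ t x s :=
  (integral_map (measurable_pi_apply s).aemeasurable hf.aestronglyMeasurable).symm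

theorem integral_quadValue_succ {s : ℕ} (hs : t ≤ s)
    (hv : Integrable (d.quadValue (s + 1)) (d.stateLaw π γ t x (s + 1))) :
    Integrable (fun y => ∫ w, d.quadValue (s + 1) (d.next y (π.act s y) w) ∂γ.law s y)
      (d.stateLaw π γ t x s) ∧
    ∫ y, d.quadValue (s + 1) y ∂d.stateLaw π γ t x (s + 1) =
      ∫ y, ∫ w, d.quadValue (s + 1) (d.next y (π.act s y) w) ∂γ.law s y
        ∂d.stateLaw π γ t x s := by
  have := γ.markov s
  have hm : Measurable fun p : (Fin n → ℝ) × (Fin k → ℝ) => d.next p.1 (π.act s p.1) p.2 :=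
    d.measurable_next π s
  rw [stateLaw_succ _ _ _ _ _ hs] at hv ⊢
  have hv' : Integrable (fun p : (Fin n → ℝ) × (Fin k → ℝ) =>
      d.quadValue (s + 1) (d.next p.1 (π.act s p.1) p.2))
      (d.stateLaw π γ t x s ⊗ₘ γ.law s) := hv.comp_measurable hm
  refine ⟨hv'.integral_compProd, ?_⟩
  rw [integral_map hm.aemeasurable hv.aestronglyMeasurable, Measure.integral_compProd hv']

theorem integrable_stageGain {s : ℕ} (hs : t ≤ s)
    (hq : Integrable (d.stageCost π s) (d.stateLaw π γ t x s))
    (hv : Integrable (d.quadValue s) (d.stateLaw π γ t x s))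
    (hv' : Integrable (d.quadValue (s + 1)) (d.stateLaw π γ t x (s + 1))) :
    Integrable (d.stageGain π γ s) (d.stateLaw π γ t x s) :=
  (hq.add (integral_quadValue_succ hs hv').1).sub hv

theorem integral_stageGain {s : ℕ} (hs : t ≤ s)
    (hq : Integrable (d.stageCost π s) (d.stateLaw π γ t x s))
    (hv : Integrable (d.quadValue s) (d.stateLaw π γ t x s))
    (hv' : Integrable (d.quadValue (s + 1)) (d.stateLaw π γ t x (s + 1))) :
    ∫ y, d.stageGain π γ s y ∂d.stateLaw π γ t x s =
      ∫ y, d.stageCost π s y ∂d.stateLaw π γ t x s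
        + (∫ y, d.quadValue (s + 1) y ∂d.stateLaw π γ t x (s + 1)
        - ∫ y, d.quadValue s y ∂d.stateLaw π γ t x s) := by
  have h := integral_quadValue_succ hs hv'
  have hadd : Integrable (fun y => d.stageCost π s y
      + ∫ w, d.quadValue (s + 1) (d.next y (π.act s y) w) ∂γ.law s y) (d.stateLaw π γ t x s) :=
    hq.add h.1
  simp only [stageGain]
  rw [integral_sub hadd hv, integral_add hq h.1, h.2]
  ring

theorem integrable_quadCost
    (hq : ∀ s, t ≤ s → s < d.T → Integrable (d.stageCost π s) (d.stateLaw π γ t x s))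
    (hv : Integrable (d.quadValue d.T) (d.stateLaw π γ t x d.T)) :
    Integrable (d.quadCost π t) (d.pathLaw π γ t x) := by
  have : d.quadCost π t = _ := funext (d.quadCost_eq π t)
  rw [this]
  refine (integrable_finsetSum _ fun s hs => ?_).add (integrable_comp_eval hv)
  exact integrable_comp_eval (hq s (Finset.mem_Ico.1 hs).1 (Finset.mem_Ico.1 hs).2)

/-- The expected quadratic cost is `quadValue` plus the expected gains of the stages. -/
theorem integral_quadCost (ht : t ≤ d.T)
    (hq : ∀ s, t ≤ s → s < d.T → Integrable (d.stageCost π s) (d.stateLaw π γ t x s))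
    (hv : ∀ s, t ≤ s → s ≤ d.T → Integrable (d.quadValue s) (d.stateLaw π γ t x s)) :
    ∫ ω, d.quadCost π t ω ∂d.pathLaw π γ t x =
      d.quadValue t x + ∑ s ∈ Finset.Ico t d.T,
        ∫ y, d.stageGain π γ s y ∂d.stateLaw π γ t x s := by
  simp_rw [quadCost_eq]
  rw [integral_add (integrable_finsetSum _ fun s hs => integrable_comp_eval
      (hq s (Finset.mem_Ico.1 hs).1 (Finset.mem_Ico.1 hs).2))
      (integrable_comp_eval (hv _ ht le_rfl)),
    integral_finsetSum _ fun s hs => integrable_comp_eval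
      (hq s (Finset.mem_Ico.1 hs).1 (Finset.mem_Ico.1 hs).2),
    integral_comp_eval (hv _ ht le_rfl)]
  have hgain : ∀ s ∈ Finset.Ico t d.T, ∫ y, d.stageGain π γ s y ∂d.stateLaw π γ t x s = _ :=
    fun s hs => integral_stageGain (Finset.mem_Ico.1 hs).1
      (hq s (Finset.mem_Ico.1 hs).1 (Finset.mem_Ico.1 hs).2)
      (hv s (Finset.mem_Ico.1 hs).1 (Finset.mem_Ico.1 hs).2.le)
      (hv (s + 1) ((Finset.mem_Ico.1 hs).1.trans s.le_succ) (Finset.mem_Ico.1 hs).2)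
  rw [Finset.sum_congr rfl hgain, Finset.sum_add_distrib,
    Finset.sum_Ico_sub (fun s => ∫ y, d.quadValue s y ∂d.stateLaw π γ t x s) ht, stateLaw_self,
    integral_dirac]
  rw [Finset.sum_congr rfl fun s hs => integral_comp_eval
    (hq s (Finset.mem_Ico.1 hs).1 (Finset.mem_Ico.1 hs).2)]
  ring

theorem lintegral_quadCost (hQ : d.Q.PosSemidef) (hQf : d.Qf.PosSemidef) (hR : d.R.PosDef)
    (hc : Integrable (d.quadCost π t) (d.pathLaw π γ t x)) :
    ∫⁻ ω, ENNReal.ofReal (d.quadCost π t ω) ∂d.pathLaw π γ t x =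
      ENNReal.ofReal (∫ ω, d.quadCost π t ω ∂d.pathLaw π γ t x) :=
  (ofReal_integral_eq_lintegral_ofReal hc
    (.of_forall fun ω => d.quadCost_nonneg π hQ hQf hR t ω)).symm

end LQData

namespace LQData

variable {n m k N : ℕ} {d : LQData n m k N}

/-! ### Upper bound: the affine policy against an arbitrary opponent -/

theorem lintegral_empirical_ne_top [NeZero N] (s : ℕ) :
    ∫⁻ w, ENNReal.ofReal (w ⬝ᵥ w) ∂d.empirical s ≠ ∞ := by
  rw [empirical, lintegral_uniform _ measurable_ofReal_dotProduct_self]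
  exact ENNReal.mul_ne_top (by simp [NeZero.ne N])
    (ENNReal.sum_ne_top.2 fun _ _ => ENNReal.ofReal_ne_top)

/-- If the chosen law has infinite second moment, the right side is infinite. Otherwise the next
value is integrable and Kantorovich duality applies, with the best-response value as the dual
function of the sample. -/
theorem Regular.ofReal_stageGain_le [NeZero N] {s : ℕ} (h : d.Regular s) (hs : s < d.T)
    (γ : OpponentPolicy n k) (y : Fin n → ℝ) :
    ENNReal.ofReal (d.stageGain d.optPolicy γ s y) ≤
      ENNReal.ofReal d.lam * wasserstein2 (γ.law s y) (d.empirical s) ^ 2 := by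
  have := γ.markov s
  by_cases hM : ∫⁻ w, ENNReal.ofReal (w ⬝ᵥ w) ∂γ.law s y = ∞
  · have hW := lintegral_dotProduct_self_le (γ.law s y) (d.empirical s)
    rw [hM, top_le_iff, ENNReal.add_eq_top] at hW
    have hW' : wasserstein2 (γ.law s y) (d.empirical s) ^ 2 = ∞ := by
      by_contra hne
      rcases hW with hW | hW
      · exact ENNReal.mul_ne_top (by simp) hne hW
      · exact ENNReal.mul_ne_top (by simp) (lintegral_empirical_ne_top s) hW
    rw [hW', ENNReal.mul_top (by simpa using h.lam_pos)]
    exact le_top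
  · have hid : MemLp (fun w => w) 2 (γ.law s y) :=
      memLp_two_of_lintegral_dotProduct_ne_top measurable_id hM
    have hnext : MemLp (fun w => d.next y (d.optPolicy.act s y) w) 2 (γ.law s y) :=
      (memLp_const (d.A *ᵥ y + d.B *ᵥ d.optPolicy.act s y)).add (hid.mulVec d.Ξ)
    have hf : Integrable (fun w => d.quadValue (s + 1) (d.next y (d.optPolicy.act s y) w))
        (γ.law s y) :=
      d.integrable_quadValue_comp hnext (s + 1)
    have hg : Integrable (fun w => d.quadValue (s + 1)
          (d.next y (d.optPolicy.act s y) (d.worst s w y))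
        - d.lam * ((d.worst s w y - w) ⬝ᵥ (d.worst s w y - w))) (d.empirical s) :=
      integrable_uniform _ _
    have := ofReal_integral_sub_integral_le h.lam_pos hf hg
      fun w' w => h.quadValue_next_sub_le y w w'
    refine le_of_eq_of_le ?_ this
    rw [empirical, integral_uniform, smul_eq_mul, stageGain, stageCost, ← h.stage_value hs y]
    congr 1
    ring

/-- A finite expected penalty bounds the second moment of each disturbance, and the closed-loop
dynamics are affine, so square integrability propagates from stage to stage. -/
theorem memLp_stateLaw_optPolicy [NeZero N] (hlam : 0 < d.lam) (γ : OpponentPolicy n k) {t : ℕ}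
    {x : Fin n → ℝ} (hpen : ∫⁻ ω, d.penalty γ t ω ∂d.pathLaw d.optPolicy γ t x ≠ ∞) {s : ℕ}
    (hts : t ≤ s) (hs : s ≤ d.T) :
    MemLp (fun y => y) 2 (d.stateLaw d.optPolicy γ t x s) := by
  induction s, hts using Nat.le_induction with
  | base =>
    rw [stateLaw_self]
    exact memLp_two_of_lintegral_dotProduct_ne_top measurable_id (by simp)
  | succ s hts ih =>
    have := γ.markov s
    have ih := ih (Nat.le_of_succ_le hs)
    have hm : Measurable fun p : (Fin n → ℝ) × (Fin k → ℝ) =>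
        d.next p.1 (d.optPolicy.act s p.1) p.2 := d.measurable_next _ s
    have hW : ∫⁻ ω, wasserstein2 (γ.law s (ω s)) (d.empirical s) ^ 2
        ∂d.pathLaw d.optPolicy γ t x ≠ ∞ := by
      intro htop
      refine hpen (top_le_iff.1 ?_)
      have hl : ENNReal.ofReal d.lam ≠ 0 := by simpa using hlam
      rw [← ENNReal.mul_top hl, ← htop, ← lintegral_const_mul' _ _ ENNReal.ofReal_ne_top]
      refine lintegral_mono fun ω => ?_
      exact Finset.single_le_sum
        (f := fun s => ENNReal.ofReal d.lam * wasserstein2 (γ.law s (ω s)) (d.empirical s) ^ 2)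
        (fun _ _ => zero_le) (Finset.mem_Ico.2 ⟨hts, hs⟩)
    have hM : ∫⁻ p, ENNReal.ofReal (p.2 ⬝ᵥ p.2)
        ∂(d.stateLaw d.optPolicy γ t x s ⊗ₘ γ.law s) ≠ ∞ := by
      have hmeas : Measurable fun y => ∫⁻ w, ENNReal.ofReal (w ⬝ᵥ w) ∂γ.law s y :=
        measurable_ofReal_dotProduct_self.lintegral_kernel
      have hmeas' : Measurable fun p : (Fin n → ℝ) × (Fin k → ℝ) =>
          ENNReal.ofReal (p.2 ⬝ᵥ p.2) := measurable_ofReal_dotProduct_self.comp measurable_snd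
      rw [Measure.lintegral_compProd hmeas']
      rw [stateLaw, lintegral_map hmeas (measurable_pi_apply s)]
      refine ne_top_of_le_ne_top ?_
        (lintegral_mono fun ω => lintegral_dotProduct_self_le (γ.law s (ω s)) (d.empirical s))
      -- These forms need no measurability of the squared distance in the state: the other summand
      -- is constant and the factor is finite.
      rw [lintegral_add_right _ measurable_const, lintegral_const_mul' _ _ (by simp),
        lintegral_const, measure_univ, mul_one]
      exact ENNReal.add_ne_top.2 ⟨ENNReal.mul_ne_top (by simp) hW,
        ENNReal.mul_ne_top (by simp) (lintegral_empirical_ne_top s)⟩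
    have hsnd : MemLp (fun p : (Fin n → ℝ) × (Fin k → ℝ) => p.2) 2
        (d.stateLaw d.optPolicy γ t x s ⊗ₘ γ.law s) :=
      memLp_two_of_lintegral_dotProduct_ne_top measurable_snd hM
    have hfst : MemLp (fun p : (Fin n → ℝ) × (Fin k → ℝ) => p.1) 2
        (d.stateLaw d.optPolicy γ t x s ⊗ₘ γ.law s) := by
      rw [← Measure.fst_compProd (d.stateLaw d.optPolicy γ t x s) (γ.law s), Measure.fst,
        memLp_map_measure_iff (g := fun y => y) aestronglyMeasurable_id measurable_fst.aemeasurable] at ih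
      exact ih
    rw [stateLaw_succ _ _ _ _ _ hts,
      memLp_map_measure_iff (g := fun y => y) aestronglyMeasurable_id hm.aemeasurable]
    exact ((hfst.mulVec d.A).add (((hfst.mulVec (d.K s)).add (memLp_const (d.L s))).mulVec
      d.B)).add (hsnd.mulVec d.Ξ)

theorem costToGo_optPolicy_le [NeZero N] (hlam : 0 < d.lam) (hQ : d.Q.PosSemidef)
    (hQf : d.Qf.PosSemidef) (hR : d.R.PosDef) (hreg : ∀ s < d.T, d.Regular s) {t : ℕ}
    (ht : t ≤ d.T) (x : Fin n → ℝ) (γ : OpponentPolicy n k) :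
    d.costToGo t x d.optPolicy γ ≤ (d.quadValue t x : EReal) := by
  by_cases hpen : ∫⁻ ω, d.penalty γ t ω ∂d.pathLaw d.optPolicy γ t x = ∞
  · rw [costToGo, hpen, EReal.coe_ennreal_top, EReal.sub_top]
    exact bot_le
  have hmem : ∀ s, t ≤ s → s ≤ d.T → MemLp (fun y => y) 2 (d.stateLaw d.optPolicy γ t x s) :=
    fun s h1 h2 => memLp_stateLaw_optPolicy hlam γ hpen h1 h2
  have hv : ∀ s, t ≤ s → s ≤ d.T →
      Integrable (d.quadValue s) (d.stateLaw d.optPolicy γ t x s) := fun s h1 h2 =>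
    d.integrable_quadValue_comp (hmem s h1 h2) s
  have hq : ∀ s, t ≤ s → s < d.T →
      Integrable (d.stageCost d.optPolicy s) (d.stateLaw d.optPolicy γ t x s) := fun s h1 h2 => by
    have h := hmem s h1 h2.le
    have hu : MemLp (d.optPolicy.act s) 2 (d.stateLaw d.optPolicy γ t x s) :=
      (h.mulVec (d.K s)).add (memLp_const (d.L s))
    exact (h.integrable_dotProduct (h.mulVec _)).add (hu.integrable_dotProduct (hu.mulVec _))
  have hgain : ∀ s ∈ Finset.Ico t d.T,
      Integrable (d.stageGain d.optPolicy γ s) (d.stateLaw d.optPolicy γ t x s) := fun s hs => by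
    obtain ⟨h1, h2⟩ := Finset.mem_Ico.1 hs
    exact integrable_stageGain h1 (hq s h1 h2) (hv s h1 h2.le) (hv (s + 1) (h1.trans s.le_succ) h2)
  rw [costToGo, lintegral_quadCost hQ hQf hR (integrable_quadCost hq (hv _ ht le_rfl))]
  refine ereal_ofReal_sub_le
    (integral_nonneg fun ω => d.quadCost_nonneg _ hQ hQf hR t ω) ?_
  rw [integral_quadCost ht hq hv, add_sub_cancel_left,
    ← Finset.sum_congr rfl fun s hs => integral_comp_eval (hgain s hs),
    ← integral_finsetSum _ fun s hs => integrable_comp_eval (hgain s hs)]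
  refine (ofReal_integral_le_lintegral_ofReal
    (integrable_finsetSum _ fun s hs => integrable_comp_eval (hgain s hs))).trans
    (lintegral_mono fun ω => ?_)
  -- The positive part is subadditive, so the comparison with the penalty is made stage by stage on
  -- each trajectory.
  refine (Finset.le_sum_of_subadditive _ ENNReal.ofReal_zero.le
    (fun _ _ => ENNReal.ofReal_add_le) _ _).trans (Finset.sum_le_sum fun s hs => ?_)
  have hs := (Finset.mem_Ico.1 hs).2
  exact (hreg s hs).ofReal_stageGain_le hs γ (ω s)

/-! ### Lower bound: an arbitrary policy against the worst-case opponent -/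

section Lower

variable [NeZero N] (d)

theorem worstPolicy_law (s : ℕ) (y : Fin n → ℝ) :
    d.worstPolicy.law s y =
      (N : ℝ≥0∞)⁻¹ • ∑ i, Measure.dirac (d.worst s (d.sample s i) y) := rfl

theorem ae_worstPolicy_law (s : ℕ) (y : Fin n → ℝ) {p : (Fin k → ℝ) → Prop}
    (hp : ∀ i, p (d.worst s (d.sample s i) y)) : ∀ᵐ w ∂d.worstPolicy.law s y, p w := by
  rw [worstPolicy_law]
  refine Measure.ae_smul_measure ?_ _
  rw [ae_iff, Measure.finsetSum_apply, Finset.sum_eq_zero_iff]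
  intro i _
  rw [← ae_iff, ae_dirac_eq]
  exact hp i

/-- Against the worst-case opponent the state takes finitely many values. -/
theorem exists_finset_ae_stateLaw_mem (π : ControlPolicy n m) (t : ℕ) (x : Fin n → ℝ) {s : ℕ}
    (hs : t ≤ s) :
    ∃ F : Finset (Fin n → ℝ), ∀ᵐ y ∂d.stateLaw π d.worstPolicy t x s, y ∈ F := by
  classical
  induction s, hs using Nat.le_induction with
  | base => exact ⟨{x}, by rw [stateLaw_self, ae_dirac_eq]; simp⟩
  | succ s hs ih =>
    have := d.worstPolicy.markov s
    obtain ⟨F, hF⟩ := ih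
    have hm : Measurable fun p : (Fin n → ℝ) × (Fin k → ℝ) =>
        d.next p.1 (π.act s p.1) p.2 := d.measurable_next _ s
    set F' := (F ×ˢ Finset.univ).image fun q : (Fin n → ℝ) × Fin N =>
      d.next q.1 (π.act s q.1) (d.worst s (d.sample s q.2) q.1)
    have hF' : MeasurableSet {y | y ∈ F'} := F'.measurableSet
    have hF'' : MeasurableSet {p : (Fin n → ℝ) × (Fin k → ℝ) |
      d.next p.1 (π.act s p.1) p.2 ∈ F'} := hm hF'
    refine ⟨F', ?_⟩
    rw [stateLaw_succ _ _ _ _ _ hs, ae_map_iff hm.aemeasurable hF',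
      Measure.ae_compProd_iff hF'']
    filter_upwards [hF] with y hy
    refine d.ae_worstPolicy_law s y fun i => ?_
    exact Finset.mem_image.2 ⟨(y, i), by simpa using hy, rfl⟩

/-- The excess cost of the input `π_s(y)` compared with the affine policy. -/
noncomputable def inputExcess (π : ControlPolicy n m) (s : ℕ) (y : Fin n → ℝ) : ℝ :=
  (π.act s y - d.optPolicy.act s y) ⬝ᵥ
    ((d.R + d.Bᵀ * d.P (s + 1) * d.B) *ᵥ (π.act s y - d.optPolicy.act s y))

/-- The cost of the coupling of the worst-case law with the samples, times `λ`. -/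
noncomputable def transportCost (s : ℕ) (y : Fin n → ℝ) : ℝ :=
  d.lam * ((N : ℝ)⁻¹ * ∑ i, (d.worst s (d.sample s i) y - d.sample s i) ⬝ᵥ
    (d.worst s (d.sample s i) y - d.sample s i))

omit [NeZero N] in
theorem measurable_inputExcess (π : ControlPolicy n m) (s : ℕ) :
    Measurable (d.inputExcess π s) := by
  have h := (π.measurable_act s).sub (d.optPolicy.measurable_act s)
  exact measurable_dotProduct h (measurable_mulVec h _)

omit [NeZero N] in
theorem measurable_transportCost (s : ℕ) : Measurable (d.transportCost s) := by
  refine ((Finset.measurable_fun_sum _ fun i _ => ?_).const_mul _).const_mul _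
  have h := (d.measurable_worstPoint s i).sub_const (d.sample s i)
  exact measurable_dotProduct h h

omit [NeZero N] in
theorem transportCost_nonneg (hlam : 0 < d.lam) (s : ℕ) (y : Fin n → ℝ) :
    0 ≤ d.transportCost s y :=
  mul_nonneg hlam.le (mul_nonneg (by positivity)
    (Finset.sum_nonneg fun _ _ => dotProduct_self_nonneg_real _))

theorem penalty_worstPolicy_le (hlam : 0 < d.lam) (s : ℕ) (y : Fin n → ℝ) :
    ENNReal.ofReal d.lam * wasserstein2 (d.worstPolicy.law s y) (d.empirical s) ^ 2 ≤
      ENNReal.ofReal (d.transportCost s y) := by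
  rw [transportCost, ENNReal.ofReal_mul hlam.le]
  refine mul_le_mul_right ?_ _
  refine (wasserstein2_uniform_sq_le _ _).trans_eq ?_
  rw [ENNReal.ofReal_mul (by positivity), ENNReal.ofReal_sum_of_nonneg
    fun _ _ => dotProduct_self_nonneg_real _, ENNReal.ofReal_inv_of_pos
    (Nat.cast_pos.2 (NeZero.pos N)), ENNReal.ofReal_natCast]
  rfl

omit [NeZero N] in
variable {d} in
theorem Regular.posDef_inputWeight {s : ℕ} (h : d.Regular s) :
    (d.R + d.Bᵀ * d.P (s + 1) * d.B).PosDef := by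
  refine h.R_posDef.add_posSemidef ?_
  simpa using h.P_posSemidef.conjTranspose_mul_mul_same d.B

omit [NeZero N] in
variable {d} in
theorem Regular.inputExcess_nonneg {s : ℕ} (h : d.Regular s) (π : ControlPolicy n m)
    (y : Fin n → ℝ) : 0 ≤ d.inputExcess π s y :=
  h.posDef_inputWeight.posSemidef.dotProduct_nonneg _

omit [NeZero N] in
variable {d} in
theorem Regular.act_eq_of_inputExcess_eq_zero {s : ℕ} (h : d.Regular s) {π : ControlPolicy n m}
    {y : Fin n → ℝ} (h0 : d.inputExcess π s y = 0) : π.act s y = d.optPolicy.act s y := by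
  by_contra hne
  exact (h.posDef_inputWeight.dotProduct_pos (sub_ne_zero.2 hne)).ne' h0

variable {d}

theorem Regular.stageGain_worstPolicy {s : ℕ} (h : d.Regular s) (hs : s < d.T)
    (π : ControlPolicy n m) (y : Fin n → ℝ) :
    d.stageGain π d.worstPolicy s y = d.inputExcess π s y + d.transportCost s y := by
  have h1 := h.stage_cost_eq y (π.act s y)
  have h2 := h.stage_value hs y
  rw [Finset.sum_sub_distrib, ← Finset.mul_sum] at h2
  rw [stageGain, stageCost, worstPolicy_law, integral_uniform, inputExcess, transportCost,
    smul_eq_mul]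
  linarith

/-- The transport cost in the stage gains pays for the penalty, leaving the input excess. Keeping
the excess, rather than only its sign, is what yields uniqueness. -/
theorem le_costToGo_worstPolicy (hlam : 0 < d.lam) (hQ : d.Q.PosSemidef)
    (hQf : d.Qf.PosSemidef) (hR : d.R.PosDef) (hreg : ∀ s < d.T, d.Regular s) {t : ℕ}
    (ht : t ≤ d.T) (x : Fin n → ℝ) (π : ControlPolicy n m) :
    ((d.quadValue t x + ∑ s ∈ Finset.Ico t d.T,
      ∫ y, d.inputExcess π s y ∂d.stateLaw π d.worstPolicy t x s : ℝ) : EReal) ≤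
      d.costToGo t x π d.worstPolicy := by
  have hint : ∀ s, t ≤ s → ∀ f : (Fin n → ℝ) → ℝ, Measurable f →
      Integrable f (d.stateLaw π d.worstPolicy t x s) := fun s hs f hf => by
    obtain ⟨F, hF⟩ := d.exists_finset_ae_stateLaw_mem π t x hs
    exact integrable_of_ae_mem_finset hf hF
  have hq : ∀ s, t ≤ s → s < d.T →
      Integrable (d.stageCost π s) (d.stateLaw π d.worstPolicy t x s) := fun s h1 _ =>
    hint s h1 _ (d.measurable_stageCost π s)
  have hv : ∀ s, t ≤ s → s ≤ d.T →
      Integrable (d.quadValue s) (d.stateLaw π d.worstPolicy t x s) := fun s h1 _ =>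
    hint s h1 _ (d.measurable_quadValue s)
  have htc : ∀ s ∈ Finset.Ico t d.T,
      Integrable (d.transportCost s) (d.stateLaw π d.worstPolicy t x s) := fun s hs =>
    hint s (Finset.mem_Ico.1 hs).1 _ (d.measurable_transportCost s)
  have hsum : ∑ s ∈ Finset.Ico t d.T, ∫ y, d.stageGain π d.worstPolicy s y
      ∂d.stateLaw π d.worstPolicy t x s =
      ∑ s ∈ Finset.Ico t d.T, ∫ y, d.inputExcess π s y ∂d.stateLaw π d.worstPolicy t x s
      + ∫ ω, ∑ s ∈ Finset.Ico t d.T, d.transportCost s (ω s)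
        ∂d.pathLaw π d.worstPolicy t x := by
    rw [integral_finsetSum _ fun s hs => integrable_comp_eval (htc s hs),
      ← Finset.sum_add_distrib]
    refine Finset.sum_congr rfl fun s hs => ?_
    obtain ⟨h1, h2⟩ := Finset.mem_Ico.1 hs
    rw [integral_comp_eval (htc s hs),
      ← integral_add (hint s h1 _ (d.measurable_inputExcess π s)) (htc s hs)]
    exact integral_congr_ae (.of_forall fun y => (hreg s h2).stageGain_worstPolicy h2 π y)
  rw [costToGo, lintegral_quadCost hQ hQf hR (integrable_quadCost hq (hv _ ht le_rfl))]
  refine le_trans (le_of_eq ?_) (le_ereal_ofReal_sub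
    (b := ∫ ω, ∑ s ∈ Finset.Ico t d.T, d.transportCost s (ω s) ∂d.pathLaw π d.worstPolicy t x)
    (integral_nonneg fun ω => d.quadCost_nonneg _ hQ hQf hR t ω)
    (integral_nonneg fun ω => Finset.sum_nonneg fun s _ => d.transportCost_nonneg hlam s _) ?_)
  · rw [integral_quadCost ht hq hv, hsum, ← add_assoc, add_sub_cancel_right]
  · rw [ofReal_integral_eq_lintegral_ofReal
      (integrable_finsetSum _ fun s hs => integrable_comp_eval (htc s hs))
      (.of_forall fun ω => Finset.sum_nonneg fun s _ => d.transportCost_nonneg hlam s _)]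
    refine lintegral_mono fun ω => ?_
    rw [ENNReal.ofReal_sum_of_nonneg fun s _ => d.transportCost_nonneg hlam s _]
    exact Finset.sum_le_sum fun s _ => d.penalty_worstPolicy_le hlam s _

/-- Nonnegative expectations with nonpositive sum all vanish, and the excess is a positive definite
form in the difference of inputs. -/
theorem ae_act_eq_of_sum_nonpos (hreg : ∀ s < d.T, d.Regular s) {t : ℕ}
    {x : Fin n → ℝ} {π : ControlPolicy n m}
    (h : ∑ s ∈ Finset.Ico t d.T,
      ∫ y, d.inputExcess π s y ∂d.stateLaw π d.worstPolicy t x s ≤ 0) {s : ℕ} (hts : t ≤ s)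
    (hs : s < d.T) :
    ∀ᵐ y ∂d.stateLaw π d.worstPolicy t x s, π.act s y = d.optPolicy.act s y := by
  have hnn : ∀ s ∈ Finset.Ico t d.T,
      0 ≤ ∫ y, d.inputExcess π s y ∂d.stateLaw π d.worstPolicy t x s := fun s hs =>
    integral_nonneg fun y => (hreg s (Finset.mem_Ico.1 hs).2).inputExcess_nonneg π y
  have h0 := (Finset.sum_eq_zero_iff_of_nonneg hnn).1 (h.antisymm (Finset.sum_nonneg hnn)) s
    (Finset.mem_Ico.2 ⟨hts, hs⟩)
  obtain ⟨F, hF⟩ := d.exists_finset_ae_stateLaw_mem π t x hts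
  rw [integral_eq_zero_iff_of_nonneg (fun y => (hreg s hs).inputExcess_nonneg π y)
    (integrable_of_ae_mem_finset (d.measurable_inputExcess π s) hF)] at h0
  exact h0.mono fun y hy => (hreg s hs).act_eq_of_inputExcess_eq_zero hy

end Lower

/-! ### Uniqueness along trajectories -/

theorem step_apply (π : ControlPolicy n m) (γ : OpponentPolicy n k) (s : ℕ) (y : Fin n → ℝ) :
    d.step π γ s y = (γ.law s y).map fun w => d.next y (π.act s y) w := by
  have := γ.markov s
  rw [step, Kernel.map_apply _ (d.measurable_next π s), Kernel.prod_apply, Kernel.id_apply,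
    Measure.dirac_prod, Measure.map_map (d.measurable_next π s) measurable_prodMk_left]
  rfl

/-- Agreement is known only under the laws generated by `π` itself; induction on time shows that
`π'` generates the same ones. -/
theorem stateLaw_congr {π π' : ControlPolicy n m} (γ : OpponentPolicy n k) {t : ℕ}
    {x : Fin n → ℝ} {s : ℕ} (hts : t ≤ s)
    (h : ∀ r, t ≤ r → r < s → ∀ᵐ y ∂d.stateLaw π γ t x r, π.act r y = π'.act r y) :
    d.stateLaw π γ t x s = d.stateLaw π' γ t x s := by
  induction s, hts using Nat.le_induction with
  | base => rw [stateLaw_self, stateLaw_self]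
  | succ s hts ih =>
    have ih := ih fun r h1 h2 => h r h1 (h2.trans s.lt_succ_self)
    rw [stateLaw_succ_eq_bind _ _ _ _ _ hts, stateLaw_succ_eq_bind _ _ _ _ _ hts, ← ih]
    refine Measure.bind_congr_right ?_
    filter_upwards [h s hts s.lt_succ_self] with y hy
    rw [step_apply, step_apply, hy]

/-! ### Regularity of the recursion -/

theorem regular_of_posSemidef (hlam : 0 < d.lam) (hR : d.R.PosDef) {t : ℕ}
    (hP : (d.P (t + 1)).PosSemidef)
    (hpen : ∀ μ : ℝ, Module.End.HasEigenvalue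
      (Matrix.toLin' (d.Ξᵀ * d.P (t + 1) * d.Ξ)) μ → μ < d.lam) : d.Regular t where
  lam_pos := hlam
  R_posDef := hR
  P_posSemidef := hP
  gap_posDef := IsHermitian.posDef_smul_one_sub
    (by simpa using (hP.conjTranspose_mul_mul_same d.Ξ).isHermitian) hpen

theorem Regular.posSemidef_P (hQ : d.Q.PosSemidef) {t : ℕ} (h : d.Regular t) (ht : t < d.T) :
    (d.P t).PosSemidef := by
  rw [d.P_step ht, Matrix.mul_assoc d.Aᵀ]
  refine hQ.add ?_
  simpa using h.posSemidef_inv_mul.conjTranspose_mul_mul_same d.A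

/-- Backward induction: semidefiniteness at `t + 1` and the eigenvalue bound there make stage `t`
regular, which gives semidefiniteness at `t`. -/
theorem posSemidef_P (hlam : 0 < d.lam) (hQ : d.Q.PosSemidef) (hQf : d.Qf.PosSemidef)
    (hR : d.R.PosDef)
    (hpen : ∀ t, 1 ≤ t → t ≤ d.T → ∀ μ : ℝ,
      Module.End.HasEigenvalue (Matrix.toLin' (d.Ξᵀ * d.P t * d.Ξ)) μ → μ < d.lam)
    {t : ℕ} (ht : t ≤ d.T) : (d.P t).PosSemidef := by
  induction ht using Nat.decreasingInduction with
  | self => rwa [P_last]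
  | of_succ t ht ih =>
    exact (regular_of_posSemidef hlam hR ih (hpen (t + 1) (by omega) ht)).posSemidef_P hQ ht

end LQData

/-! ### Assembling the saddle point -/

theorem mainTheorem1 {n m k N : ℕ} [NeZero N] (d : LQData n m k N)
    (hT : 0 < d.T) (hlam : 0 < d.lam)
    (hQ : d.Q.PosSemidef) (hQf : d.Qf.PosSemidef) (hR : d.R.PosDef)
    (hpen : ∀ t, 1 ≤ t → t ≤ d.T → ∀ μ : ℝ,
      Module.End.HasEigenvalue (Matrix.toLin' (d.Ξᵀ * d.P t * d.Ξ)) μ → μ < d.lam) :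
    -- the Riccati recursion is well defined: its inverses exist, and `P_t` is symmetric PSD
    (∀ t ≤ d.T, (d.P t).PosSemidef) ∧
    (∀ t < d.T,
      IsUnit (1 + d.P (t + 1) * d.Φ) ∧
      IsUnit (1 - (1 / d.lam) • (d.Ξᵀ * d.P (t + 1) * d.Ξ)) ∧
      IsUnit (1 - (1 / d.lam) • (d.P (t + 1) * d.Ξ * d.Ξᵀ)) ∧
      IsUnit (d.lam • (1 : Matrix (Fin k) (Fin k) ℝ) - d.Ξᵀ * d.P (t + 1) * d.Ξ)) ∧
    -- the value functions are quadratic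
    (∀ t ≤ d.T, ∀ x : Fin n → ℝ,
      d.valueFn t x = ((x ⬝ᵥ (d.P t *ᵥ x) + 2 * (d.r t ⬝ᵥ x) + d.z t : ℝ) : EReal)) ∧
    -- the affine policy is optimal from every stage and state, and for the whole problem
    (∀ t ≤ d.T, ∀ x : Fin n → ℝ, d.IsOptimalAt t x d.optPolicy) ∧
    (∀ x : Fin n → ℝ, (⨆ γ, d.J x d.optPolicy γ) = ⨅ π, ⨆ γ, d.J x π γ) ∧
    -- uniqueness: whatever is optimal from stage `t` and state `x` uses `K_t x + L_t` there
    (∀ π : ControlPolicy n m, ∀ t < d.T, ∀ x : Fin n → ℝ,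
      d.IsOptimalAt t x π → π.act t x = d.K t *ᵥ x + d.L t) ∧
    (∀ π : ControlPolicy n m, (∀ t < d.T, ∀ x : Fin n → ℝ, d.IsOptimalAt t x π) →
      ∀ t < d.T, π.act t = d.optPolicy.act t) ∧
    -- uniqueness for a fixed initial state, along the optimal trajectories
    (∀ (π : ControlPolicy n m) (x : Fin n → ℝ),
      (⨆ γ, d.J x π γ) = (⨅ π', ⨆ γ, d.J x π' γ) →
      ∀ᵐ ω ∂d.pathLaw d.optPolicy d.worstPolicy 0 x,
        ∀ t < d.T, π.act t (ω t) = d.K t *ᵥ ω t + d.L t) ∧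
    -- the finitely supported policy is a worst case for the affine policy
    (∀ t ≤ d.T, ∀ x : Fin n → ℝ,
      d.costToGo t x d.optPolicy d.worstPolicy = (⨆ γ, d.costToGo t x d.optPolicy γ)) ∧
    (∀ x : Fin n → ℝ,
      d.J x d.optPolicy d.worstPolicy = (⨆ γ, d.J x d.optPolicy γ) ∧
      d.J x d.optPolicy d.worstPolicy = ⨅ π, ⨆ γ, d.J x π γ) := by

  have hP : ∀ t ≤ d.T, (d.P t).PosSemidef := fun t ht =>
    LQData.posSemidef_P hlam hQ hQf hR hpen ht
  have hreg : ∀ t < d.T, d.Regular t := fun t ht =>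
    LQData.regular_of_posSemidef hlam hR (hP (t + 1) ht) (hpen (t + 1) (by omega) ht)
  have hU : ∀ t ≤ d.T, ∀ x γ, d.costToGo t x d.optPolicy γ ≤ (d.quadValue t x : EReal) :=
    fun t ht x γ => LQData.costToGo_optPolicy_le hlam hQ hQf hR hreg ht x γ
  have hnn : ∀ (t : ℕ) (x : Fin n → ℝ) (π : ControlPolicy n m), 0 ≤ ∑ s ∈ Finset.Ico t d.T,
      ∫ y, d.inputExcess π s y ∂d.stateLaw π d.worstPolicy t x s := fun t x π =>
    Finset.sum_nonneg fun s hs => integral_nonneg fun y =>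
      (hreg s (Finset.mem_Ico.1 hs).2).inputExcess_nonneg π y
  have hL : ∀ t ≤ d.T, ∀ x π, ((d.quadValue t x + ∑ s ∈ Finset.Ico t d.T,
      ∫ y, d.inputExcess π s y ∂d.stateLaw π d.worstPolicy t x s : ℝ) : EReal) ≤
      d.costToGo t x π d.worstPolicy :=
    fun t ht x π => LQData.le_costToGo_worstPolicy hlam hQ hQf hR hreg ht x π
  have hL' : ∀ t ≤ d.T, ∀ x π, (d.quadValue t x : EReal) ≤ d.costToGo t x π d.worstPolicy :=
    fun t ht x π => le_trans (EReal.coe_le_coe_iff.2 (le_add_of_nonneg_right (hnn t x π)))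
      (hL t ht x π)
  have hV : ∀ t ≤ d.T, ∀ x, d.valueFn t x = (d.quadValue t x : EReal) := fun t ht x =>
    le_antisymm (iInf_le_of_le d.optPolicy (iSup_le (hU t ht x)))
      (le_iInf fun π => le_iSup_of_le d.worstPolicy (hL' t ht x π))
  have hS : ∀ t ≤ d.T, ∀ x, (⨆ γ, d.costToGo t x d.optPolicy γ) = (d.quadValue t x : EReal) :=
    fun t ht x => le_antisymm (iSup_le (hU t ht x))
      (le_iSup_of_le d.worstPolicy (hL' t ht x d.optPolicy))
  have hW : ∀ t ≤ d.T, ∀ x, d.costToGo t x d.optPolicy d.worstPolicy = (d.quadValue t x : EReal) :=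
    fun t ht x => le_antisymm (hU t ht x _) (hL' t ht x _)
  have hc : 0 < (1 / d.T : ℝ) := by positivity
  have hcE : (0 : EReal) ≤ ((1 / d.T : ℝ) : EReal) := EReal.coe_nonneg.2 hc.le
  have hJU : ∀ x γ, d.J x d.optPolicy γ ≤ ((1 / d.T : ℝ) : EReal) * (d.quadValue 0 x : EReal) :=
    fun x γ => mul_le_mul_of_nonneg_left (hU 0 (Nat.zero_le _) x γ) hcE
  have hJL : ∀ x π, ((1 / d.T : ℝ) : EReal) * (d.quadValue 0 x : EReal) ≤ d.J x π d.worstPolicy :=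
    fun x π => mul_le_mul_of_nonneg_left (hL' 0 (Nat.zero_le _) x π) hcE
  have hJS : ∀ x, (⨆ γ, d.J x d.optPolicy γ) =
      ((1 / d.T : ℝ) : EReal) * (d.quadValue 0 x : EReal) := fun x =>
    le_antisymm (iSup_le (hJU x)) (le_iSup_of_le d.worstPolicy (hJL x d.optPolicy))
  have hJV : ∀ x, (⨅ π, ⨆ γ, d.J x π γ) =
      ((1 / d.T : ℝ) : EReal) * (d.quadValue 0 x : EReal) := fun x =>
    le_antisymm (iInf_le_of_le d.optPolicy (hJS x).le)
      (le_iInf fun π => le_iSup_of_le d.worstPolicy (hJL x π))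
  have hJW : ∀ x, d.J x d.optPolicy d.worstPolicy =
      ((1 / d.T : ℝ) : EReal) * (d.quadValue 0 x : EReal) := fun x =>
    le_antisymm (hJU x _) (hJL x _)
  have huniq : ∀ π : ControlPolicy n m, ∀ t < d.T, ∀ x : Fin n → ℝ,
      d.IsOptimalAt t x π → π.act t x = d.K t *ᵥ x + d.L t := fun π t ht x hπ => by
    have h1 := (hL t ht.le x π).trans (le_iSup (fun γ => d.costToGo t x π γ) d.worstPolicy)
    rw [show (⨆ γ, d.costToGo t x π γ) = _ from hπ, hV t ht.le x, EReal.coe_le_coe_iff] at h1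
    -- At the starting stage the state law is a Dirac mass, so almost sure agreement is agreement at
    -- `x`.
    have h2 := LQData.ae_act_eq_of_sum_nonpos hreg (by linarith) le_rfl ht
    rw [LQData.stateLaw_self, ae_dirac_eq] at h2
    exact h2
  refine ⟨hP, fun t ht => ⟨(hreg t ht).isUnit_one_add, (hreg t ht).isUnit_one_sub,
    isUnit_one_sub_smul_mul_mul_transpose (hreg t ht).isUnit_one_sub,
    (hreg t ht).gap_posDef.isUnit⟩, hV, fun t ht x => (hS t ht x).trans (hV t ht x).symm,
    fun x => (hJS x).trans (hJV x).symm, huniq,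
    fun π hπ t ht => funext fun x => huniq π t ht x (hπ t ht x), fun π x hπ => ?_,
    fun t ht x => (hW t ht x).trans (hS t ht x).symm,
    fun x => ⟨(hJW x).trans (hJS x).symm, (hJW x).trans (hJV x).symm⟩⟩
  have h1 : d.J x π d.worstPolicy ≤ ((1 / d.T : ℝ) : EReal) * (d.quadValue 0 x : EReal) := by
    rw [← hJV x, ← hπ]
    exact le_iSup (fun γ => d.J x π γ) d.worstPolicy
  have h2 := (mul_le_mul_of_nonneg_left (hL 0 (Nat.zero_le _) x π) hcE).trans h1
  rw [← EReal.coe_mul, ← EReal.coe_mul, EReal.coe_le_coe_iff] at h2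
  have h3 := le_of_mul_le_mul_left h2 hc
  have hae : ∀ s < d.T, ∀ᵐ y ∂d.stateLaw π d.worstPolicy 0 x s,
      π.act s y = d.optPolicy.act s y := fun s hs =>
    LQData.ae_act_eq_of_sum_nonpos hreg (by linarith) (Nat.zero_le _) hs
  refine ae_all_iff.2 fun t => ?_
  by_cases ht : t < d.T
  · have h4 := hae t ht
    -- Transfers the statement from the trajectory law of `π` to that of `optPolicy`.
    rw [LQData.stateLaw_congr d.worstPolicy (Nat.zero_le t) fun r _ hr => hae r (hr.trans ht)] at h4
    exact (ae_of_ae_map (measurable_pi_apply t).aemeasurable h4).mono fun ω h _ => h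
  · exact .of_forall fun ω h => absurd h ht
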